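/- Let $s\ge 0$, $T>0$ and let $q\in L^\infty(0,1)$ be real. Let $\mathcal L y=-y''+qy$ be the Sturm-Liouville operator in $L^2(0,1)$ with Dirichlet conditions $y(0)=y(1)=0$ (domain $H^2\cap H^1_0$), and assume that all its eigenvalues are positive. For $r\ge 0$, $\mathcal L^{r}$ is the operator that multiplies each eigenfunction of eigenvalue $\lambda$ by $\lambda^{r}$; $W^s_{\mathcal L}=\{f\in L^2(0,1):\mathcal L^{s/2}f\in L^2(0,1)\}$ with norm $\|f\|_{W^s_{\mathcal L}}=\|\mathcal L^{s/2}f\|_{L^2}$. A net $(f_\varepsilon)_{\varepsilon\in(0,1]}$ in a normed space $X$ is *$X$-moderate* if $\|f_\varepsilon\|_X\le C\varepsilon^{-N}$ for some $N\in\mathbb N_0$, $C>0$ and all $\varepsilon\in(0,1]$, and *$X$-negligible* if for every $k>0$ there is $C_k>0$ with $\|f_\varepsilon\|_X\le C_k\varepsilon^k$ for all $\varepsilon\in(0,1]$. A *regularisation* of a distribution on $(0,1)$ is a net of functions that converges to it in $\mathcal D'(0,1)$ as $\varepsilon\to0^+$ (for instance, by convolution with a mollifier). Let $a,b,u_0,u_1\in\mathcal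 D'(0,1)$ with $a,b$ non-negative (that is, regularised by non-negative nets). Then the very weak solution of $$\partial_t^2u+\mathcal L^su+a(x)u+b(x)u_t=0,\quad u(0,x)=u_0(x),\quad u_t(0,x)=u_1(x),\quad u(t,0)=u(t,1)=0,\qquad (t,x)\in[0,T]\times(0,1),$$ is unique in the following sense. Let $(a_\varepsilon),(\tilde a_\varepsilon)$ and $(b_\varepsilon),(\tilde b_\varepsilon)$ be non-negative $L^\infty$-moderate regularisations of $a$ and of $b$ such that $(a_\varepsilon-\tilde a_\varepsilon)$ and $(b_\varepsilon-\tilde b_\varepsilon)$ are $L^\infty$-negligible; let $(u_{0,\varepsilon}),(\tilde u_{0,\varepsilon})$ be $W^s_{\mathcal L}$-moderate regularisations of $u_0$ with $W^s_{\mathcal L}$-negligible difference, and $(u_{1,\varepsilon}),(\tilde u_{1,\varepsilon})$ be $L^2$-moderate regularisations of $u_1$ with $L^2$-negligible difference. Suppose that, for every $\varepsilon\in(0,1]$, $u_\varepsilon$ and $\tilde u_\varepsilon$ in $C([0,T];W^s_{\mathcal L})\cap C^1([0,T];L^2(0,1))$ solve the above problem with $(a,b,u_0,u_1)$ replaced by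 $(a_\varepsilon,b_\varepsilon,u_{0,\varepsilon},u_{1,\varepsilon})$ and by $(\tilde a_\varepsilon,\tilde b_\varepsilon,\tilde u_{0,\varepsilon},\tilde u_{1,\varepsilon})$ respectively, the equation being understood in the sense of distributions with respect to $\mathcal L$ (tested against elements of $\bigcap_m\mathrm{Dom}(\mathcal L^m)$). Then $(u_\varepsilon(t,\cdot)-\tilde u_\varepsilon(t,\cdot))_\varepsilon$ is $L^2$-negligible for all $t\in[0,T]$, with constants $C_k$ independent of $t$. The same conclusion holds for arbitrary nets with these moderateness, non-negativity and negligibility properties, whether or not they regularise given distributions. -/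

import Mathlib

open MeasureTheory Set Filter Topology
open scoped ENNReal Distributions

noncomputable section

namespace FracSL

/-- Lebesgue measure on the interval `(0,1)`. -/
abbrev μ01 : Measure ℝ := (volume : Measure ℝ).restrict (Ioo (0 : ℝ) 1)

/-- The complex Hilbert space `L²(0,1)`. -/
abbrev L2 : Type := Lp ℂ 2 μ01

/-- The space `L^∞(0,1)` of real functions. -/
abbrev Linf : Type := Lp ℝ ∞ μ01

/-- The interval `(0,1)` as an open set, on which distributions live. -/
def I01 : TopologicalSpace.Opens ℝ := ⟨Ioo (0 : ℝ) 1, isOpen_Ioo⟩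

/-! ### The Sturm-Liouville operator -/

/-- `SL q y g`: `y` lies in the domain `H²(0,1) ∩ H¹₀(0,1)` of the Dirichlet Sturm-Liouville operator
and `-y'' + q y = g`. The element `y` is represented by a function `Y` that vanishes at `0` and `1`
and is differentiable on `[0,1]`, and whose derivative `Z` is absolutely continuous with
`Z' = q Y - g` almost everywhere (that is, `Z` is an indefinite integral of `q Y - g`). -/
def SL (q : Linf) (y g : L2) : Prop :=
  ∃ Y Z : ℝ → ℂ, (⇑y =ᵐ[μ01] Y) ∧ Y 0 = 0 ∧ Y 1 = 0 ∧
    (∀ x ∈ Icc (0 : ℝ) 1, HasDerivWithinAt Y (Z x) (Icc 0 1) x) ∧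
    (∀ x ∈ Icc (0 : ℝ) 1, Z x = Z 0 + ∫ t in (0 : ℝ)..x, ((q t : ℂ) * Y t - g t))

/-- `φ` is an eigenfunction of the Dirichlet Sturm-Liouville operator with eigenvalue `l`. -/
def IsEigenpair (q : Linf) (l : ℝ) (φ : L2) : Prop :=
  φ ≠ 0 ∧ SL q φ ((l : ℂ) • φ)

/-- All eigenvalues of the operator are positive. -/
def PositiveSpectrum (q : Linf) : Prop :=
  ∀ (l : ℝ) (φ : L2), IsEigenpair q l φ → 0 < l

/-! ### Fractional powers, Sobolev spaces, test functions -/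

/-- `IsPow q r f g`: `f` lies in the domain of the fractional power of order `r` and its image is `g`.
The power acts on every eigenfunction of eigenvalue `l` as multiplication by `l ^ r`; in terms of
Fourier coefficients, `⟨φ, g⟩ = l ^ r ⟨φ, f⟩` for every eigenpair `(l, φ)`. -/
def IsPow (q : Linf) (r : ℝ) (f g : L2) : Prop :=
  ∀ (l : ℝ) (φ : L2), IsEigenpair q l φ →
    inner ℂ φ g = ((l ^ r : ℝ) : ℂ) * inner ℂ φ f

/-- Membership in the Sobolev space `W^s` of the operator: the power of order `s / 2` maps `f` into
`L²`. (For `s ≥ 0` and positive spectrum, `W^s` is a subspace of `L²`.) -/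
def MemW (q : Linf) (s : ℝ) (f : L2) : Prop :=
  ∃ g : L2, IsPow q (s / 2) f g

open Classical in
/-- The fractional power of order `r`, extended by `0` outside its domain. -/
def pow (q : Linf) (r : ℝ) (f : L2) : L2 :=
  if h : ∃ g : L2, IsPow q r f g then h.choose else 0

/-- The norm of `W^s`: the `L²` norm of the power of order `s / 2`. -/
def normW (q : Linf) (s : ℝ) (f : L2) : ℝ := ‖pow q (s / 2) f‖

/-- Test functions of the operator: the intersection of the domains of all its integer powers.
`ψ j` is the `j`-th iterate of the operator applied to `φ`. -/
def IsTest (q : Linf) (φ : L2) : Prop :=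
  ∃ ψ : ℕ → L2, ψ 0 = φ ∧ ∀ j : ℕ, SL q (ψ j) (ψ (j + 1))

/-! ### Solutions of the wave equation -/

/-- `u` is a solution, in the class `C([0,T]; W^s) ∩ C¹([0,T]; L²)`, of
`u_tt + 𝓛^s u + a u + b u_t = 0` on `[0,T] × (0,1)`, `u(0) = u₀`, `u_t(0) = u₁`, with the Dirichlet
boundary conditions. Here `v = u_t`; the power of order `s` and the second time derivative are taken
in the space of `𝓛`-distributions, that is, after pairing with an arbitrary test function `φ` of the
operator, whose `s`-th power is `χ`. The boundary conditions are carried by the operator: its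
eigenfunctions vanish at `0` and `1`, and `u(t)` belongs to `W^s`. -/
def IsSolution (q : Linf) (s T : ℝ) (a b : Linf) (u₀ u₁ : L2) (u : ℝ → L2) : Prop :=
  (∀ t ∈ Icc (0 : ℝ) T, MemW q s (u t)) ∧
  ContinuousOn (fun t => pow q (s / 2) (u t)) (Icc 0 T) ∧
  ∃ v : ℝ → L2,
    (∀ t ∈ Icc (0 : ℝ) T, HasDerivWithinAt u (v t) (Icc 0 T) t) ∧
    ContinuousOn v (Icc 0 T) ∧
    u 0 = u₀ ∧ v 0 = u₁ ∧
    ∀ φ χ : L2, IsTest q φ → IsPow q s φ χ → ∀ t ∈ Icc (0 : ℝ) T,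
      HasDerivWithinAt (fun τ => inner ℂ φ (v τ))
        (-inner ℂ χ (u t) - inner ℂ φ (((a • u t : L2)) + (b • v t : L2))) (Icc 0 T) t

/-! ### Nets, moderateness, negligibility, regularisation

A net `(f_ε)`, `ε ∈ (0,1]`, is a function of a real variable of which only the values on `(0,1]`
matter. -/

/-- The net is moderate with respect to the norm `nrm`. -/
def IsModerate {X : Type*} (nrm : X → ℝ) (f : ℝ → X) : Prop :=
  ∃ N : ℕ, ∃ C : ℝ, 0 < C ∧ ∀ ε ∈ Ioc (0 : ℝ) 1, nrm (f ε) ≤ C * ε ^ (-(N : ℝ))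

/-- The net is negligible with respect to the norm `nrm`. -/
def IsNegligible {X : Type*} (nrm : X → ℝ) (f : ℝ → X) : Prop :=
  ∀ k : ℝ, 0 < k → ∃ C : ℝ, 0 < C ∧ ∀ ε ∈ Ioc (0 : ℝ) 1, nrm (f ε) ≤ C * ε ^ k

/-- A non-negative `L^∞`-moderate net. -/
def IsCoeffNet (a : ℝ → Linf) : Prop :=
  (∀ ε ∈ Ioc (0 : ℝ) 1, 0 ≤ a ε) ∧ IsModerate norm a

/-- A `W^s`-moderate net. -/
def IsWModerate (q : Linf) (s : ℝ) (f : ℝ → L2) : Prop :=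
  (∀ ε ∈ Ioc (0 : ℝ) 1, MemW q s (f ε)) ∧ IsModerate (normW q s) f

/-- A `W^s`-negligible net. -/
def IsWNegligible (q : Linf) (s : ℝ) (f : ℝ → L2) : Prop :=
  (∀ ε ∈ Ioc (0 : ℝ) 1, MemW q s (f ε)) ∧ IsNegligible (normW q s) f

/-- The nets of `L^p` functions that regularise the distribution `D` on `(0,1)`: they converge to `D`
in the sense of distributions as `ε → 0+`. This includes the nets obtained by convolution with a
Friedrichs mollifier. -/
def Regularisations {F : Type*} [NormedAddCommGroup F] [NormedSpace ℝ F] (p : ℝ≥0∞)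
    (D : 𝓓'(I01, F)) : Set (ℝ → Lp F p μ01) :=
  {f | ∀ φ : 𝓓(I01, ℝ),
    Tendsto (fun ε => ∫ x, φ x • f ε x ∂μ01) (𝓝[>] 0) (𝓝 (D φ))}

/-! ### Uniqueness of very weak solutions -/

/-- Uniqueness of the solution net up to negligible nets, when the nets of coefficients and of data
are allowed to range over the classes `A`, `B`, `U`, `V`: negligible changes of the nets change the
net of solutions by an `L²`-negligible net, with constants uniform in `t ∈ [0,T]`. -/
def NetUniqueness (q : Linf) (s T : ℝ) (A B : Set (ℝ → Linf)) (U V : Set (ℝ → L2)) : Prop :=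
  ∀ a a' : ℝ → Linf, a ∈ A → a' ∈ A → IsCoeffNet a → IsCoeffNet a' →
    IsNegligible norm (fun ε => a ε - a' ε) →
  ∀ b b' : ℝ → Linf, b ∈ B → b' ∈ B → IsCoeffNet b → IsCoeffNet b' →
    IsNegligible norm (fun ε => b ε - b' ε) →
  ∀ u₀ u₀' : ℝ → L2, u₀ ∈ U → u₀' ∈ U → IsWModerate q s u₀ → IsWModerate q s u₀' →
    IsWNegligible q s (fun ε => u₀ ε - u₀' ε) →
  ∀ u₁ u₁' : ℝ → L2, u₁ ∈ V → u₁' ∈ V → IsModerate norm u₁ → IsModerate norm u₁' →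
    IsNegligible norm (fun ε => u₁ ε - u₁' ε) →
  ∀ u u' : ℝ → ℝ → L2,
    (∀ ε ∈ Ioc (0 : ℝ) 1, IsSolution q s T (a ε) (b ε) (u₀ ε) (u₁ ε) (u ε)) →
    (∀ ε ∈ Ioc (0 : ℝ) 1, IsSolution q s T (a' ε) (b' ε) (u₀' ε) (u₁' ε) (u' ε)) →
  ∀ k : ℝ, 0 < k → ∃ C : ℝ, 0 < C ∧ ∀ ε ∈ Ioc (0 : ℝ) 1, ∀ t ∈ Icc (0 : ℝ) T,
    ‖u ε t - u' ε t‖ ≤ C * ε ^ k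

/-- The initial/boundary problem with distributional coefficients `a`, `b` and data `u₀`, `u₁` has a
unique very weak solution: the nets range over the regularisations of the given distributions. -/
def HasUniqueVeryWeakSolution (q : Linf) (s T : ℝ) (a b : 𝓓'(I01, ℝ)) (u₀ u₁ : 𝓓'(I01, ℂ)) :
    Prop :=
  NetUniqueness q s T (Regularisations ∞ a) (Regularisations ∞ b)
    (Regularisations 2 u₀) (Regularisations 2 u₁)

end FracSL

end

noncomputable section

open scoped InnerProductSpace

namespace FracSL

/-! ### The Volterra operator -/

/-! Fix ε. The difference `w` of the two solutions satisfies w'' + 𝓛^s w + a w + b w' = F with F =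
-(a - a')u' - (b - b')v', where v' is the time derivative of the second solution u'. As a and b are
non-negative, the energy ‖w'‖² + ‖𝓛^{s/2} w‖² + ⟨a w, w⟩ grows at a rate independent of the
coefficients (`energy_le`). Hence solutions are bounded polynomially, not exponentially, in the
coefficients (`norm_solution_le`), and `norm_sub_le_of_isSolution` bounds `w` by a moderate factor
times a sum of negligible terms. Convergence of the nets to distributions plays no role.

The equation holds only against test functions, so the energy is computed in coordinates along a
Hilbert basis of eigenfunctions (`exists_eigenbasis`). To get the basis, the Green operator of -y''
is factored as BB* with B compact; a shift by a constant c absorbs q and gives a compact symmetric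
resolvent (`exists_shifted_resolvent`), to which the spectral theorem applies. Positivity keeps the
eigenvalues away from 0, so the W^s norm dominates the L² norm. -/

instance isProbabilityMeasure_μ01 : IsProbabilityMeasure μ01 := ⟨by simp [μ01]⟩

/-- The primitive of `f` that vanishes at `0`. -/
def prim (f : ℝ → ℂ) (x : ℝ) : ℂ := ∫ t in (0 : ℝ)..x, f t

lemma ae_restrict_Ioc_of_ae_μ01 {P : ℝ → Prop} (h : ∀ᵐ x ∂μ01, P x) {x y : ℝ}
    (hx : 0 ≤ x) (hy : y ≤ 1) : ∀ᵐ t ∂(volume.restrict (Ioc x y)), P t := by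
  have h1 : ∀ᵐ x ∂(volume.restrict (Ioc (0 : ℝ) 1)), P x := by
    rwa [← restrict_Ioo_eq_restrict_Ioc]
  exact ae_restrict_of_ae_restrict_of_subset (Ioc_subset_Ioc hx hy) h1

lemma integral_congr_of_ae_μ01 {f g : ℝ → ℂ} (h : f =ᵐ[μ01] g) {x y : ℝ}
    (hx : 0 ≤ x) (hxy : x ≤ y) (hy : y ≤ 1) : ∫ t in x..y, f t = ∫ t in x..y, g t := by
  rw [intervalIntegral.integral_of_le hxy, intervalIntegral.integral_of_le hxy]
  exact integral_congr_ae (ae_restrict_Ioc_of_ae_μ01 h hx hy)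

lemma prim_congr {f g : ℝ → ℂ} (h : f =ᵐ[μ01] g) {x : ℝ} (hx : x ∈ Icc (0 : ℝ) 1) :
    prim f x = prim g x :=
  integral_congr_of_ae_μ01 h le_rfl hx.1 hx.2

lemma intervalIntegrable_of_integrable_μ01 {f : ℝ → ℂ} (hf : Integrable f μ01) {x y : ℝ}
    (hx : x ∈ Icc (0 : ℝ) 1) (hy : y ∈ Icc (0 : ℝ) 1) : IntervalIntegrable f volume x y := by
  have h : IntegrableOn f (Ioo 0 1) := hf
  rw [← integrableOn_Icc_iff_integrableOn_Ioo] at h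
  exact (intervalIntegrable_iff_integrableOn_Icc_of_le zero_le_one |>.2 h).mono_set
    (by rw [uIcc_of_le (zero_le_one' ℝ)]; exact uIcc_subset_Icc hx hy)

lemma integrable_L2 (f : L2) : Integrable f μ01 :=
  (Lp.memLp f).integrable (by norm_num)

lemma prim_sub {f : ℝ → ℂ} (hf : Integrable f μ01) {x y : ℝ}
    (hx : x ∈ Icc (0 : ℝ) 1) (hy : y ∈ Icc (0 : ℝ) 1) :
    prim f y - prim f x = ∫ t in x..y, f t :=
  intervalIntegral.integral_interval_sub_left
    (intervalIntegrable_of_integrable_μ01 hf (by simp) hy)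
    (intervalIntegrable_of_integrable_μ01 hf (by simp) hx)

lemma continuousOn_prim {f : ℝ → ℂ} (hf : Integrable f μ01) :
    ContinuousOn (prim f) (Icc 0 1) := by
  have h := intervalIntegrable_of_integrable_μ01 hf (x := 0) (y := 1) (by simp) (by simp)
  have := intervalIntegral.continuousOn_primitive_interval' h (by simp : (0:ℝ) ∈ uIcc (0:ℝ) 1)
  rwa [uIcc_of_le (zero_le_one' ℝ)] at this

lemma measure_Ioc_ne_top (x y : ℝ) : μ01 (Ioc x y) ≠ ∞ := measure_ne_top _ _

/-- Writing increments of primitives as inner products gives their Hölder bound by Cauchy-Schwarz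
and the continuity of point sampling. -/
lemma inner_indicator_Ioc (f : L2) {x y : ℝ} (hx : 0 ≤ x) (hxy : x ≤ y) (hy : y ≤ 1) :
    ⟪(indicatorConstLp 2 measurableSet_Ioc (measure_Ioc_ne_top x y) (1 : ℂ) : L2), f⟫_ℂ
      = ∫ t in x..y, f t := by
  rw [L2.inner_indicatorConstLp_eq_inner_setIntegral ℂ, intervalIntegral.integral_of_le hxy]
  simp only [RCLike.inner_apply, map_one, mul_one]
  have : μ01.restrict (Ioc x y) = volume.restrict (Ioc x y) := by
    rw [μ01, restrict_Ioo_eq_restrict_Ioc, Measure.restrict_restrict measurableSet_Ioc,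
      inter_eq_self_of_subset_left (Ioc_subset_Ioc hx hy)]
  rw [this]

lemma norm_integral_le_sqrt (f : L2) {x y : ℝ} (hx : 0 ≤ x) (hxy : x ≤ y) (hy : y ≤ 1) :
    ‖∫ t in x..y, f t‖ ≤ √(y - x) * ‖f‖ := by
  rw [← inner_indicator_Ioc f hx hxy hy]
  refine (norm_inner_le_norm _ _).trans (mul_le_mul_of_nonneg_right ?_ (norm_nonneg _))
  rw [norm_indicatorConstLp (by norm_num) (by norm_num)]
  simp only [norm_one, one_mul, ENNReal.toReal_ofNat, ← Real.sqrt_eq_rpow]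
  apply Real.sqrt_le_sqrt
  calc μ01.real (Ioc x y) ≤ volume.real (Ioc x y) :=
        ENNReal.toReal_mono (by simp) (Measure.restrict_apply_le _ _)
    _ = y - x := by simp [hxy]

lemma norm_prim_le (f : L2) {x : ℝ} (hx : x ∈ Icc (0 : ℝ) 1) : ‖prim f x‖ ≤ ‖f‖ := by
  refine (norm_integral_le_sqrt f le_rfl hx.1 hx.2).trans ?_
  exact mul_le_of_le_one_left (norm_nonneg _) (Real.sqrt_le_one.2 (by linarith [hx.2]))

lemma ae_mem_Ioo : ∀ᵐ x ∂μ01, x ∈ Ioo (0 : ℝ) 1 := ae_restrict_mem measurableSet_Ioo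

lemma memLp_of_continuousOn {F : ℝ → ℂ} (hF : ContinuousOn F (Icc 0 1)) : MemLp F 2 μ01 := by
  obtain ⟨C, hC⟩ := isCompact_Icc.exists_bound_of_continuousOn hF
  refine MemLp.of_bound ((hF.mono Ioo_subset_Icc_self).aestronglyMeasurable measurableSet_Ioo) C ?_
  filter_upwards [ae_mem_Ioo] with x hx using hC x (Ioo_subset_Icc_self hx)

lemma norm_le_of_ae_norm_le {f : L2} {C : ℝ} (hC : 0 ≤ C) (h : ∀ᵐ x ∂μ01, ‖f x‖ ≤ C) :
    ‖f‖ ≤ C := by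
  simpa [measureUnivNNReal] using Lp.norm_le_of_ae_bound hC h

/-- The Volterra operator: `f` is mapped to its primitive that vanishes at `0`. -/
def volterra : L2 →L[ℂ] L2 :=
  LinearMap.mkContinuous
    { toFun := fun f => (memLp_of_continuousOn (continuousOn_prim (integrable_L2 f))).toLp (prim f)
      map_add' := fun f g => by
        rw [← MemLp.toLp_add]
        refine MemLp.toLp_congr _ _ ?_
        filter_upwards [ae_mem_Ioo] with x hx
        have hx' := Ioo_subset_Icc_self hx
        rw [prim_congr (Lp.coeFn_add f g) hx']
        exact intervalIntegral.integral_add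
          (intervalIntegrable_of_integrable_μ01 (integrable_L2 f) (by simp) hx')
          (intervalIntegrable_of_integrable_μ01 (integrable_L2 g) (by simp) hx')
      map_smul' := fun c f => by
        rw [RingHom.id_apply, ← MemLp.toLp_const_smul]
        refine MemLp.toLp_congr _ _ ?_
        filter_upwards [ae_mem_Ioo] with x hx
        rw [prim_congr (Lp.coeFn_smul c f) (Ioo_subset_Icc_self hx)]
        exact intervalIntegral.integral_smul c f }
    1 (fun f => by
      rw [one_mul]
      refine norm_le_of_ae_norm_le (norm_nonneg _) ?_
      filter_upwards [MemLp.coeFn_toLp (memLp_of_continuousOn (continuousOn_prim (integrable_L2 f))),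
        ae_mem_Ioo] with x h hx
      have h' : (MemLp.toLp (prim f) (memLp_of_continuousOn
        (continuousOn_prim (integrable_L2 f))) : L2) x = prim f x := h
      simpa [h'] using norm_prim_le f (Ioo_subset_Icc_self hx))

lemma coeFn_volterra (f : L2) : volterra f =ᵐ[μ01] prim f :=
  MemLp.coeFn_toLp (memLp_of_continuousOn (continuousOn_prim (integrable_L2 f)))

/-! ### Compactness of the Volterra operator -/

lemma memLp_step (n : ℕ) (c : Fin (n + 1) → ℂ) :
    MemLp (fun x : ℝ => c (Fin.ofNat (n + 1) ⌊((n : ℝ) + 1) * x⌋₊)) 2 μ01 :=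
  MemLp.of_bound
    ((Measurable.of_discrete (f := fun k : ℕ => c (Fin.ofNat (n + 1) k))).comp
      (Nat.measurable_floor.comp (measurable_const_mul ((n : ℝ) + 1)))).aestronglyMeasurable
    ‖c‖ (ae_of_all _ fun _ => norm_le_pi_norm c _)

/-- Step functions with `n + 1` steps of equal length. -/
def stepMap (n : ℕ) : (Fin (n + 1) → ℂ) →ₗ[ℂ] L2 where
  toFun c := (memLp_step n c).toLp _
  map_add' _ _ := rfl
  map_smul' _ _ := rfl

lemma coeFn_stepMap (n : ℕ) (c : Fin (n + 1) → ℂ) :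
    stepMap n c =ᵐ[μ01] fun x => c (Fin.ofNat (n + 1) ⌊((n : ℝ) + 1) * x⌋₊) :=
  MemLp.coeFn_toLp (memLp_step n c)

/-- The values of the primitive at the points `k / (n + 1)`. -/
def samples (n : ℕ) : L2 →L[ℂ] (Fin (n + 1) → ℂ) :=
  ContinuousLinearMap.pi fun k => innerSL ℂ
    (indicatorConstLp 2 measurableSet_Ioc (measure_Ioc_ne_top 0 (k / ((n : ℝ) + 1))) (1 : ℂ))

lemma samples_apply (n : ℕ) (f : L2) (k : Fin (n + 1)) :
    samples n f k = prim f (k / ((n : ℝ) + 1)) := by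
  have hk : (k : ℝ) ≤ n := by exact_mod_cast Nat.lt_succ_iff.1 k.2
  exact inner_indicator_Ioc f le_rfl (by positivity) (by rw [div_le_one (by positivity)]; linarith)

/-- The step function takes the value of the primitive at the left end of each cell; primitives are
Hölder-1/2, so the error on a cell of length 1/(n+1) is at most the root of that length. This makes
`volterra` a norm limit of finite-rank operators. -/
lemma norm_volterra_sub_le (n : ℕ) :
    ‖volterra - (stepMap n).toContinuousLinearMap ∘L samples n‖ ≤ √(1 / ((n : ℝ) + 1)) := by
  refine ContinuousLinearMap.opNorm_le_bound _ (by positivity) fun f => ?_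
  refine norm_le_of_ae_norm_le (by positivity) ?_
  filter_upwards [Lp.coeFn_sub (volterra f) (stepMap n (samples n f)), coeFn_volterra f,
    coeFn_stepMap n (samples n f), ae_mem_Ioo] with x h1 h2 h3 hx
  have hn : (0 : ℝ) < (n : ℝ) + 1 := by positivity
  set k := ⌊((n : ℝ) + 1) * x⌋₊ with hk
  have hk1 : (k : ℝ) ≤ ((n : ℝ) + 1) * x := Nat.floor_le (by nlinarith [hx.1])
  have hk2 : ((n : ℝ) + 1) * x < k + 1 := Nat.lt_floor_add_one _
  have hk3 : k < n + 1 := by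
    have : (k : ℝ) < (n : ℝ) + 1 := by nlinarith [hx.2]
    exact_mod_cast this
  have hle : (k : ℝ) / ((n : ℝ) + 1) ≤ x := by rw [div_le_iff₀ hn]; linarith
  -- `Fin.ofNat` reduces modulo n + 1, which changes nothing for points of (0,1).
  have h4 : ((Fin.ofNat (n + 1) k : Fin (n + 1)) : ℕ) = k := by
    simp [Fin.ofNat, Nat.mod_eq_of_lt hk3]
  change ‖(volterra f - stepMap n (samples n f) : L2) x‖ ≤ _
  rw [h1, Pi.sub_apply, h2, h3, samples_apply, h4, prim_sub (integrable_L2 f)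
    ⟨by positivity, hle.trans hx.2.le⟩ (Ioo_subset_Icc_self hx)]
  refine (norm_integral_le_sqrt f (by positivity) hle hx.2.le).trans ?_
  gcongr
  rw [sub_le_iff_le_add, ← add_div, le_div_iff₀ hn]
  linarith

lemma isCompactOperator_volterra : IsCompactOperator volterra := by
  have hF : ∀ n : ℕ, IsCompactOperator ((stepMap n).toContinuousLinearMap ∘L samples n) :=
    fun n => (isCompactOperator_of_locallyCompactSpace_rng
      (stepMap n).toContinuousLinearMap).comp_clm (samples n)
  refine isCompactOperator_of_tendsto (l := atTop)
    (F := fun n : ℕ => (stepMap n).toContinuousLinearMap ∘L samples n) ?_ (Eventually.of_forall hF)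
  rw [tendsto_iff_norm_sub_tendsto_zero]
  have h0 : Tendsto (fun n : ℕ => √(1 / ((n : ℝ) + 1))) atTop (𝓝 0) := by
    simpa [Function.comp_def] using
      (Real.continuous_sqrt.tendsto 0).comp (tendsto_one_div_add_atTop_nhds_zero_nat (𝕜 := ℝ))
  exact squeeze_zero (fun _ => norm_nonneg _) (fun n => by
    rw [norm_sub_rev]; exact norm_volterra_sub_le n) h0

/-! ### The mean and the adjoint of the Volterra operator -/

/-- The constant function `1`. -/
def oneL2 : L2 := Lp.const 2 μ01 (1 : ℂ)

lemma coeFn_oneL2 : oneL2 =ᵐ[μ01] fun _ => 1 := Lp.coeFn_const ..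

/-- The projection onto the constant functions. -/
def meanL2 : L2 →L[ℂ] L2 := (innerSL ℂ oneL2).smulRight oneL2

lemma inner_oneL2 (f : L2) : ⟪oneL2, f⟫_ℂ = prim f 1 := by
  rw [L2.inner_def, prim, intervalIntegral.integral_of_le zero_le_one,
    ← restrict_Ioo_eq_restrict_Ioc]
  refine integral_congr_ae ?_
  filter_upwards [coeFn_oneL2] with x hx
  simp [hx]

lemma coeFn_meanL2 (f : L2) : meanL2 f =ᵐ[μ01] fun _ => prim f 1 := by
  have : meanL2 f = (prim f 1) • oneL2 := by simp [meanL2, inner_oneL2]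
  rw [this]
  filter_upwards [Lp.coeFn_smul (prim f 1) oneL2, coeFn_oneL2] with x h1 h2
  simp [h1, h2]

lemma prim_eq_integral_indicator (f : ℝ → ℂ) {x : ℝ} (hx : x ∈ Ioo (0 : ℝ) 1) :
    prim f x = ∫ t, (Iio x).indicator f t ∂μ01 := by
  rw [prim, intervalIntegral.integral_of_le hx.1.le, integral_Ioc_eq_integral_Ioo,
    integral_indicator measurableSet_Iio, Measure.restrict_restrict measurableSet_Iio]
  congr 2
  ext t
  simp only [mem_Ioo, mem_inter_iff, mem_Iio]
  constructor
  · rintro ⟨h1, h2⟩; exact ⟨h2, h1, h2.trans hx.2⟩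
  · rintro ⟨h1, h2, _⟩; exact ⟨h2, h1⟩

lemma prim_one_sub_eq_integral_indicator (g : L2) {x : ℝ} (hx : x ∈ Ioo (0 : ℝ) 1) :
    prim g 1 - prim g x = ∫ t, (Ioi x).indicator g t ∂μ01 := by
  rw [prim_sub (integrable_L2 g) (Ioo_subset_Icc_self hx) (by simp),
    intervalIntegral.integral_of_le hx.2.le, integral_Ioc_eq_integral_Ioo,
    integral_indicator measurableSet_Ioi, Measure.restrict_restrict measurableSet_Ioi]
  congr 2
  ext t
  simp only [mem_Ioo, mem_inter_iff, mem_Ioi]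
  constructor
  · rintro ⟨h1, h2⟩; exact ⟨h1, hx.1.trans h1, h2⟩
  · rintro ⟨h1, _, h2⟩; exact ⟨h1, h2⟩

/-- Fubini on the triangle t < x: the adjoint sends g to its integral from t to 1, which is the mean
of g minus its primitive. -/
lemma inner_volterra (f g : L2) :
    ⟪volterra f, g⟫_ℂ = ⟪f, meanL2 g - volterra g⟫_ℂ := by
  have e1 : ⟪volterra f, g⟫_ℂ = ∫ x, ∫ t, {p : ℝ × ℝ | p.2 < p.1}.indicator
      (fun p => g p.1 * starRingEnd ℂ (f p.2)) (x, t) ∂μ01 ∂μ01 := by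
    rw [L2.inner_def]
    refine integral_congr_ae ?_
    filter_upwards [coeFn_volterra f, ae_mem_Ioo] with x h1 hx
    rw [h1, prim_eq_integral_indicator f hx, RCLike.inner_apply, ← integral_conj,
      ← integral_const_mul]
    congr 1; ext t
    by_cases h : t < x <;> simp [indicator, h]
  have e2 : ⟪f, meanL2 g - volterra g⟫_ℂ = ∫ t, ∫ x, {p : ℝ × ℝ | p.2 < p.1}.indicator
      (fun p => g p.1 * starRingEnd ℂ (f p.2)) (x, t) ∂μ01 ∂μ01 := by
    rw [L2.inner_def]
    refine integral_congr_ae ?_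
    filter_upwards [Lp.coeFn_sub (meanL2 g) (volterra g), coeFn_meanL2 g, coeFn_volterra g,
      ae_mem_Ioo] with t h0 h2 h1 ht
    rw [h0, Pi.sub_apply, h1, h2, prim_one_sub_eq_integral_indicator g ht, RCLike.inner_apply,
      ← integral_mul_const]
    congr 1; ext x
    by_cases h : t < x <;> simp [indicator, h]
  rw [e1, e2]
  refine integral_integral_swap ?_
  refine Integrable.indicator ?_ (measurableSet_lt measurable_snd measurable_fst)
  exact Integrable.mul_prod (integrable_L2 g)
    ((RCLike.conjLIE (K := ℂ)).toContinuousLinearEquiv.toContinuousLinearMap.integrable_comp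
      (integrable_L2 f))

lemma inner_meanL2 (f g : L2) : ⟪meanL2 f, g⟫_ℂ = ⟪f, meanL2 g⟫_ℂ := by
  simp [meanL2, inner_smul_left, inner_smul_right, mul_comm]

lemma meanL2_meanL2 (f : L2) : meanL2 (meanL2 f) = meanL2 f := by
  have h : ⟪oneL2, oneL2⟫_ℂ = 1 := by
    rw [inner_oneL2, prim_congr coeFn_oneL2 (by simp)]; simp [prim]
  simp only [meanL2, ContinuousLinearMap.smulRight_apply, innerSL_apply_apply, inner_smul_right, h,
    mul_one]

/-- A square root of the solution operator of `-y'' = g`, `y(0) = y(1) = 0`. -/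
def sqrtGreen : L2 →L[ℂ] L2 := volterra ∘L (1 - meanL2)

lemma isCompactOperator_sqrtGreen : IsCompactOperator sqrtGreen :=
  isCompactOperator_volterra.comp_clm (1 - meanL2)

lemma adjoint_sqrtGreen_apply (f : L2) :
    ContinuousLinearMap.adjoint sqrtGreen f = meanL2 (volterra f) - volterra f := by
  refine ext_inner_left ℂ fun h => ?_
  rw [ContinuousLinearMap.adjoint_inner_right, sqrtGreen, ContinuousLinearMap.comp_apply,
    inner_volterra]
  simp only [_root_.sub_apply, one_apply_eq_self, inner_sub_left,
    inner_sub_right, inner_meanL2, meanL2_meanL2]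
  ring

/-- Subtracting the mean makes the second primitive vanish at 1 as well as at 0, so BB* is the
Dirichlet Green operator of -y''. -/
lemma green_apply (f : L2) : sqrtGreen (ContinuousLinearMap.adjoint sqrtGreen f) =
    volterra (meanL2 (volterra f) - volterra f) := by
  rw [adjoint_sqrtGreen_apply, sqrtGreen]
  simp [meanL2_meanL2]

/-! ### Multiplication operators -/

/-- Multiplication by a bounded function. -/
def mulOp (q : Linf) : L2 →L[ℂ] L2 :=
  LinearMap.mkContinuous
    { toFun := fun f => (q • f : L2)
      map_add' := fun f g => Lp.add_smul q f g
      map_smul' := fun c f => by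
        refine Lp.ext ?_
        filter_upwards [Lp.coeFn_lpSMul (r := 2) q (c • f), Lp.coeFn_smul c (q • f : L2),
          Lp.coeFn_lpSMul (r := 2) q f, Lp.coeFn_smul c f] with x h1 h2 h3 h4
        simp [h1, h2, h3, h4]
        ring }
    ‖q‖ (fun f => Lp.norm_smul_le q f)

lemma mulOp_apply (q : Linf) (f : L2) : mulOp q f = (q • f : L2) := rfl

lemma norm_mulOp_apply_le (q : Linf) (f : L2) : ‖mulOp q f‖ ≤ ‖q‖ * ‖f‖ := Lp.norm_smul_le q f

lemma mulOp_sub (a b : Linf) (f : L2) : mulOp (a - b) f = mulOp a f - mulOp b f := by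
  rw [sub_eq_add_neg, mulOp_apply, Lp.smul_add, Lp.neg_smul, ← sub_eq_add_neg]; rfl

lemma coeFn_mulOp (q : Linf) (f : L2) : mulOp q f =ᵐ[μ01] fun x => (q x : ℂ) * f x := by
  filter_upwards [Lp.coeFn_lpSMul (r := 2) q f] with x hx
  rw [mulOp_apply, hx]; simp

lemma inner_mulOp (q : Linf) (f g : L2) : ⟪mulOp q f, g⟫_ℂ = ⟪f, mulOp q g⟫_ℂ := by
  rw [L2.inner_def, L2.inner_def]
  refine integral_congr_ae ?_
  filter_upwards [coeFn_mulOp q f, coeFn_mulOp q g] with x h1 h2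
  simp [h1, h2]; ring

lemma re_inner_mulOp_nonneg {a : Linf} (ha : 0 ≤ a) (f : L2) : 0 ≤ (⟪mulOp a f, f⟫_ℂ).re := by
  rw [L2.inner_def]
  have h := L2.integrable_inner (𝕜 := ℂ) (mulOp a f) f
  change 0 ≤ RCLike.re (∫ x, ⟪mulOp a f x, f x⟫_ℂ ∂μ01)
  rw [← integral_re h]
  refine integral_nonneg_of_ae ?_
  filter_upwards [coeFn_mulOp a f, (Lp.coeFn_nonneg a).2 ha] with x h1 h2
  have : ⟪mulOp a f x, f x⟫_ℂ = ((a x * ‖f x‖ ^ 2 : ℝ) : ℂ) := by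
    rw [h1, RCLike.inner_apply, map_mul, Complex.conj_ofReal, mul_left_comm, RCLike.mul_conj]
    simp
  rw [this]
  have h2' : 0 ≤ a x := h2
  change 0 ≤ ((a x * ‖f x‖ ^ 2 : ℝ) : ℂ).re
  rw [Complex.ofReal_re]; positivity

/-! ### The Dirichlet problem -/

lemma prim_zero (f : ℝ → ℂ) : prim f 0 = 0 := by simp [prim]

lemma eqOn_prim_of_hasDerivWithinAt {Y Z : ℝ → ℂ} (hZ : ContinuousOn Z (Icc 0 1)) (h0 : Y 0 = 0)
    (hY : ∀ x ∈ Icc (0 : ℝ) 1, HasDerivWithinAt Y (Z x) (Icc 0 1) x) {x : ℝ}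
    (hx : x ∈ Icc (0 : ℝ) 1) : Y x = prim Z x := by
  have := intervalIntegral.integral_eq_sub_of_hasDerivAt_of_le (f := Y) (f' := Z) hx.1
    (fun y hy => ((hY y ⟨hy.1, hy.2.trans hx.2⟩).continuousWithinAt).mono
      (Icc_subset_Icc_right hx.2))
    (fun y hy => (hY y ⟨hy.1.le, hy.2.le.trans hx.2⟩).hasDerivAt
      (Icc_mem_nhds hy.1 (hy.2.trans_le hx.2)))
    (ContinuousOn.intervalIntegrable (by
      rw [uIcc_of_le hx.1]; exact hZ.mono (Icc_subset_Icc_right hx.2)))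
  rw [prim, this, h0, sub_zero]

lemma hasDerivWithinAt_prim {Z : ℝ → ℂ} (hZ : ContinuousOn Z (Icc 0 1)) {x : ℝ}
    (hx : x ∈ Icc (0 : ℝ) 1) : HasDerivWithinAt (prim Z) (Z x) (Icc 0 1) x := by
  have : Fact (x ∈ Icc (0 : ℝ) 1) := ⟨hx⟩
  refine intervalIntegral.integral_hasDerivWithinAt_right ?_ ?_ (hZ x hx)
  · exact ContinuousOn.intervalIntegrable (by
      rw [uIcc_of_le hx.1]; exact hZ.mono (Icc_subset_Icc_right hx.2))
  · exact hZ.stronglyMeasurableAtFilter_nhdsWithin measurableSet_Icc x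

/-- The solution operator of `-y'' = h`, `y(0) = y(1) = 0` inverts the Sturm-Liouville operator
with the potential moved to the right-hand side. -/
lemma sl_iff_eq_green (q : Linf) (y g : L2) :
    SL q y g ↔ y = sqrtGreen (ContinuousLinearMap.adjoint sqrtGreen (g - mulOp q y)) := by
  rw [green_apply]
  set h : L2 := g - mulOp q y with hh
  have hcoe : ∀ Y : ℝ → ℂ, y =ᵐ[μ01] Y →
      (fun t => (q t : ℂ) * Y t - g t) =ᵐ[μ01] fun t => -h t := by
    intro Y hY
    filter_upwards [Lp.coeFn_sub g (mulOp q y), coeFn_mulOp q y, hY] with x h1 h2 h3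
    rw [hh, h1, Pi.sub_apply, h2, ← h3]; ring
  have hint : ∀ Y : ℝ → ℂ, y =ᵐ[μ01] Y → ∀ x ∈ Icc (0 : ℝ) 1,
      ∫ t in (0 : ℝ)..x, ((q t : ℂ) * Y t - g t) = -prim h x := by
    intro Y hY x hx
    rw [integral_congr_of_ae_μ01 (hcoe Y hY) le_rfl hx.1 hx.2, prim,
      intervalIntegral.integral_neg]
  set k : L2 := meanL2 (volterra h) - volterra h with hk
  have hPc := continuousOn_prim (integrable_L2 h)
  have hkz : k =ᵐ[μ01] fun x => prim (prim h) 1 - prim h x := by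
    filter_upwards [Lp.coeFn_sub (meanL2 (volterra h)) (volterra h), coeFn_meanL2 (volterra h),
      coeFn_volterra h] with x h1 h2 h3
    rw [hk, h1, Pi.sub_apply, h2, h3, prim_congr (coeFn_volterra h) (by simp)]
  have hsub : ∀ z : ℂ, prim (fun x => z - prim h x) 1 = z - prim (prim h) 1 := by
    intro z
    rw [prim, intervalIntegral.integral_sub (by simp) (ContinuousOn.intervalIntegrable
      (by rwa [uIcc_of_le zero_le_one]))]
    simp [prim]
  constructor
  · rintro ⟨Y, Z, hyY, hY0, hY1, hY, hZ⟩
    have hZ' : ∀ x ∈ Icc (0 : ℝ) 1, Z x = Z 0 - prim h x := fun x hx => by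
      rw [hZ x hx, hint Y hyY x hx, sub_eq_add_neg]
    have hZc : ContinuousOn Z (Icc 0 1) :=
      (continuousOn_const.sub hPc).congr hZ'
    have hYp := fun x hx => eqOn_prim_of_hasDerivWithinAt hZc hY0 hY (x := x) hx
    have hZae : Z =ᵐ[μ01] fun x => Z 0 - prim h x := by
      filter_upwards [ae_mem_Ioo] with x hx using hZ' x (Ioo_subset_Icc_self hx)
    -- The boundary condition at 1 fixes the only free constant, the initial slope.
    have hZ0 : Z 0 = prim (prim h) 1 := by
      have := hYp 1 (by simp)
      rw [hY1, prim_congr hZae (by simp), hsub] at this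
      exact (sub_eq_zero.1 this.symm)
    refine Lp.ext ?_
    filter_upwards [hyY, coeFn_volterra k, ae_mem_Ioo] with x h1 h2 hx
    rw [h1, h2, hYp x (Ioo_subset_Icc_self hx)]
    refine prim_congr ?_ (Ioo_subset_Icc_self hx)
    filter_upwards [hZae, hkz] with t h1 h2
    rw [h1, h2, hZ0]
  · intro hy
    set Z : ℝ → ℂ := fun x => prim (prim h) 1 - prim h x with hZ
    have hZc : ContinuousOn Z (Icc 0 1) := continuousOn_const.sub hPc
    have hyY : y =ᵐ[μ01] prim Z := by
      rw [hy]
      filter_upwards [coeFn_volterra k, ae_mem_Ioo] with x h1 hx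
      rw [h1, prim_congr hkz (Ioo_subset_Icc_self hx)]
    refine ⟨prim Z, Z, hyY, prim_zero _, by rw [hsub, sub_self],
      fun x hx => hasDerivWithinAt_prim hZc hx, fun x hx => ?_⟩
    rw [hint _ hyY x hx, hZ]
    simp only [prim_zero]
    ring

/-- By continuity `Y`, hence `Z`, vanishes on all of [0,1]; so every primitive of g vanishes, and
Lebesgue differentiation gives g = 0. This will exclude the eigenvalue 0 of the resolvent. -/
lemma eq_zero_of_sl_zero {q : Linf} {g : L2} (hg : SL q 0 g) : g = 0 := by
  obtain ⟨Y, Z, hyY, hY0, hY1, hY, hZ⟩ := hg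
  have hY' : ∀ᵐ x ∂μ01, Y x = 0 := by
    filter_upwards [hyY, Lp.coeFn_zero ℂ 2 μ01] with x h1 h2
    rw [← h1, h2]; rfl
  have hYc : ContinuousOn Y (Icc 0 1) := fun x hx => (hY x hx).continuousWithinAt
  have hY2 : ∀ x ∈ Icc (0 : ℝ) 1, Y x = 0 := by
    have h1 : EqOn Y (fun _ => 0) (Ioo 0 1) :=
      Measure.eqOn_open_of_ae_eq (μ := volume) hY' isOpen_Ioo
        (hYc.mono Ioo_subset_Icc_self) continuousOn_const
    intro x hx
    rcases eq_or_lt_of_le hx.1 with h | h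
    · rw [← h, hY0]
    rcases eq_or_lt_of_le hx.2 with h' | h'
    · rw [h', hY1]
    exact h1 ⟨h, h'⟩
  have hZ0 : ∀ x ∈ Icc (0 : ℝ) 1, Z x = 0 := fun x hx =>
    (uniqueDiffOn_Icc zero_lt_one x hx).eq_deriv _ (hY x hx)
      ((hasDerivWithinAt_const x (Icc 0 1) (0 : ℂ)).congr hY2 (hY2 x hx))
  have hprim : ∀ x ∈ Icc (0 : ℝ) 1, prim g x = 0 := by
    intro x hx
    have h1 := hZ x hx
    rw [hZ0 x hx, hZ0 0 (by simp), zero_add] at h1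
    have h2 : ∫ t in (0 : ℝ)..x, ((q t : ℂ) * Y t - g t) = ∫ t in (0 : ℝ)..x, -g t :=
      integral_congr_of_ae_μ01 (by filter_upwards [hY'] with t ht; simp [ht]) le_rfl hx.1 hx.2
    rw [h2, intervalIntegral.integral_neg, zero_eq_neg] at h1
    exact h1
  refine Lp.ext ?_
  have hd := (intervalIntegrable_of_integrable_μ01 (integrable_L2 g) (x := 0) (y := 1)
    (by simp) (by simp)).ae_hasDerivAt_integral
  filter_upwards [ae_restrict_of_ae hd, ae_mem_Ioo, Lp.coeFn_zero ℂ 2 μ01] with x h1 hx h0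
  have h2 : HasDerivAt (prim g) (g x) x :=
    h1 (by rw [uIcc_of_le zero_le_one]; exact Ioo_subset_Icc_self hx) 0 (by simp)
  have h3 : HasDerivAt (prim g) 0 x := by
    refine (hasDerivAt_const x (0 : ℂ)).congr_of_eventuallyEq ?_
    filter_upwards [Icc_mem_nhds hx.1 hx.2] with t ht using hprim t ht
  rw [h0, h2.unique h3]; rfl

/-! ### Compact symmetric operators -/

section Abstract

universe w

variable {H : Type w} [NormedAddCommGroup H] [InnerProductSpace ℂ H]

/-- A real number that is not an eigenvalue of a compact operator has positive distance from
the real eigenvalues. -/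
lemma exists_le_abs_sub_eigenvalue (K : H →L[ℂ] H) (hK : IsCompactOperator K) {z : ℝ}
    (hz : z ≠ 0) (h : ∀ x, K x = (z : ℂ) • x → x = 0) :
    ∃ δ > 0, ∀ (m : ℝ) (x : H), x ≠ 0 → K x = (m : ℂ) • x → δ ≤ |m - z| := by
  have h1 : ¬ Module.End.HasEigenvalue (K : Module.End ℂ H) (z : ℂ) := by
    intro h2
    obtain ⟨x, hx, hx0⟩ := h2.exists_hasEigenvector
    exact hx0 (h x (Module.End.mem_eigenspace_iff.1 hx))
  -- Fredholm alternative: off the spectrum, K - z is bounded below.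
  obtain ⟨δ, hδ, hb⟩ := antilipschitzWith_iff_exists_mul_le_norm.1
    (hK.antilipschitz_of_not_hasEigenvalue (by exact_mod_cast hz) h1)
  refine ⟨δ, hδ, fun m x hx hKx => ?_⟩
  have h2 : (K - (z : ℂ) • 1) x = ((m - z : ℝ) : ℂ) • x := by
    simp [hKx, sub_smul]
  have h3 := hb x
  rw [h2, norm_smul, Complex.norm_real, Real.norm_eq_abs] at h3
  exact le_of_mul_le_mul_right h3 (norm_pos_iff.2 hx)

/-- Distinct vectors are √2 apart, so balls of radius 1/2 around them are disjoint. Countability is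
needed for dominated convergence along finite subsets of the basis. -/
lemma _root_.Orthonormal.countable_index [TopologicalSpace.SeparableSpace H] {ι : Type*} {v : ι → H}
    (hv : Orthonormal ℂ v) : Countable ι := by
  refine Set.countable_univ_iff.1 (Set.PairwiseDisjoint.countable_of_isOpen
    (s := fun i => Metric.ball (v i) (1 / 2)) (a := univ) ?_ (fun i _ => Metric.isOpen_ball)
    (fun i _ => ⟨v i, Metric.mem_ball_self (by norm_num)⟩))
  intro i _ j _ hij
  refine Metric.ball_disjoint_ball ?_
  have h1 : ‖v i - v j‖ ^ 2 = 2 := by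
    rw [@norm_sub_sq ℂ, hv.1, hv.1, hv.2 hij]; norm_num
  rw [dist_eq_norm]
  nlinarith [norm_nonneg (v i - v j)]

variable [CompleteSpace H]

open ContinuousLinearMap in
/-- If `c` dominates the norm of the symmetric operator `Q`, then `y = BB*(g - Qy)` is solved by
a compact symmetric operator applied to `g + cy`. -/
lemma exists_shifted_resolvent (B Q : H →L[ℂ] H) (hB : IsCompactOperator B)
    (hQ : ∀ f g, ⟪Q f, g⟫_ℂ = ⟪f, Q g⟫_ℂ) (c : ℝ) (hc : ∀ f, ‖Q f‖ ≤ c * ‖f‖) :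
    ∃ K : H →L[ℂ] H, IsCompactOperator K ∧ (∀ f g, ⟪K f, g⟫_ℂ = ⟪f, K g⟫_ℂ) ∧
      ∀ y g : H, y = B (adjoint B (g - Q y)) ↔ y = K (g + (c : ℂ) • y) := by
  -- With y = Bz, the equation z = B*(g - QBz) reads Mz = B*(g + cy). Since Q + c ≥ 0, M is
  -- symmetric with M ≥ 1, hence invertible, and K = B M⁻¹ B*.
  set M : H →L[ℂ] H := 1 + adjoint B ∘L (Q + (c : ℂ) • 1) ∘L B with hM
  have hMapply : ∀ x, M x = x + adjoint B (Q (B x) + (c : ℂ) • B x) := fun x => by simp [hM]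
  have hMsymm : ∀ x y, ⟪M x, y⟫_ℂ = ⟪x, M y⟫_ℂ := by
    intro x y
    rw [hMapply, hMapply, inner_add_left, inner_add_right, adjoint_inner_left,
      adjoint_inner_right, inner_add_left, inner_add_right, hQ, inner_smul_left, inner_smul_right,
      Complex.conj_ofReal]
  have hMcoer : ∀ x, ‖x‖ ^ 2 * ((1 : NNReal) : ℝ) ≤ ‖⟪M x, x⟫_ℂ‖ := by
    intro x
    refine le_trans ?_ (Complex.re_le_norm _)
    rw [hMapply, inner_add_left, adjoint_inner_left, inner_add_left, inner_smul_left,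
      Complex.conj_ofReal, inner_self_eq_norm_sq_to_K, inner_self_eq_norm_sq_to_K]
    have h1 : -(c * ‖B x‖ ^ 2) ≤ (⟪Q (B x), B x⟫_ℂ).re := by
      have h2 := (Complex.abs_re_le_norm _).trans (norm_inner_le_norm (𝕜 := ℂ) (Q (B x)) (B x))
      have h3 := mul_le_mul_of_nonneg_right (hc (B x)) (norm_nonneg (B x))
      have h4 := (abs_le.1 h2).1
      nlinarith
    have h5 : ((‖x‖ : ℂ) ^ 2 + (⟪Q (B x), B x⟫_ℂ + (c : ℂ) * (‖B x‖ : ℂ) ^ 2)).re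
        = ‖x‖ ^ 2 + ((⟪Q (B x), B x⟫_ℂ).re + c * ‖B x‖ ^ 2) := by
      simp only [Complex.add_re, ← Complex.ofReal_pow, ← Complex.ofReal_mul, Complex.ofReal_re]
    change _ ≤ ((‖x‖ : ℂ) ^ 2 + (⟪Q (B x), B x⟫_ℂ + (c : ℂ) * (‖B x‖ : ℂ) ^ 2)).re
    rw [h5]
    simp only [NNReal.coe_one, mul_one]
    linarith
  obtain ⟨U, hU⟩ := isUnit_of_forall_le_norm_inner_map M one_pos hMcoer
  set N : H →L[ℂ] H := ↑U⁻¹ with hN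
  have hMN : ∀ x, M (N x) = x := fun x => by
    rw [← hU, hN, ← mul_apply_eq_comp, U.mul_inv, one_apply_eq_self]
  have hNM : ∀ x, N (M x) = x := fun x => by
    rw [← hU, hN, ← mul_apply_eq_comp, U.inv_mul, one_apply_eq_self]
  have hNsymm : ∀ x y, ⟪N x, y⟫_ℂ = ⟪x, N y⟫_ℂ := fun x y => by
    conv_lhs => rw [← hMN y]
    rw [← hMsymm, hMN]
  refine ⟨B ∘L N ∘L adjoint B, hB.comp_clm (N ∘L adjoint B), fun f g => ?_, fun y g => ?_⟩
  · simp only [comp_apply]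
    rw [← adjoint_inner_right, hNsymm, adjoint_inner_left]
  · simp only [comp_apply]
    constructor
    · intro hy
      set z := adjoint B (g - Q y) with hz
      have : N (adjoint B (g + (c : ℂ) • y)) = z := by
        rw [← hNM z, hMapply, ← hy]
        nth_rw 1 [hz]
        have e : g - Q y + (Q y + (c : ℂ) • y) = g + (c : ℂ) • y := by abel
        rw [← map_add, e]
      rw [this, ← hy]
    · intro hy
      set z := N (adjoint B (g + (c : ℂ) • y)) with hz
      have h1 : z + adjoint B (Q y + (c : ℂ) • y) = adjoint B (g + (c : ℂ) • y) := by
        have := hMapply z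
        rw [← hy] at this
        rw [← this, hz, hMN]
      have h2 : adjoint B (g - Q y) = z := by
        rw [← eq_sub_iff_add_eq, ← map_sub] at h1
        rw [h1]; congr 1; abel
      rw [h2, ← hy]

/-- The eigenspaces of a symmetric operator have orthonormal bases that fit together. -/
lemma exists_orthonormal_eigenvectors (K : H →L[ℂ] H)
    (hsymm : ∀ f g, ⟪K f, g⟫_ℂ = ⟪f, K g⟫_ℂ) :
    ∃ (ι : Type w) (v : ι → H) (m : ι → ℂ), Orthonormal ℂ v ∧ (∀ i, K (v i) = m i • v i) ∧
      ∀ x : H, (∀ i, ⟪x, v i⟫_ℂ = 0) → ∀ (z : ℂ) (y : H), K y = z • y → ⟪x, y⟫_ℂ = 0 := by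
  have hs : (K : H →ₗ[ℂ] H).IsSymmetric := hsymm
  have hcomp : ∀ z : ℂ, CompleteSpace (Module.End.eigenspace (K : Module.End ℂ H) z) := by
    intro z
    have : (Module.End.eigenspace (K : Module.End ℂ H) z : Set H) = {x | K x = z • x} := by
      ext x; exact Module.End.mem_eigenspace_iff
    refine IsClosed.completeSpace_coe (hs := ?_)
    rw [this]
    exact isClosed_eq K.continuous (continuous_const_smul z)
  choose S b _ using
    fun z : ℂ => exists_hilbertBasis ℂ (Module.End.eigenspace (K : Module.End ℂ H) z)
  let v : (Σ z : ℂ, S z) → H := fun a => (b a.1 a.2 : Module.End.eigenspace (K : Module.End ℂ H) a.1)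
  have hv : Orthonormal ℂ v :=
    hs.orthogonalFamily_eigenspaces.orthonormal_sigma_orthonormal fun z => (b z).orthonormal
  have hKv : ∀ a, K (v a) = a.1 • v a := fun a => Module.End.mem_eigenspace_iff.1 (b a.1 a.2).2
  refine ⟨Σ z : ℂ, S z, v, fun a => a.1, hv, hKv, fun x hx z y hy => ?_⟩
  have hsum := (b z).hasSum_repr ⟨y, Module.End.mem_eigenspace_iff.2 hy⟩
  have hsum' := (hsum.mapL (Module.End.eigenspace (K : Module.End ℂ H) z).subtypeL).mapL
    (innerSL ℂ x)
  refine hsum'.unique ?_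
  have h0 : ∀ i, ⟪x, ((b z i : Module.End.eigenspace (K : Module.End ℂ H) z) : H)⟫_ℂ = 0 :=
    fun i => hx ⟨z, i⟩
  convert hasSum_zero with i
  rw [map_smul, map_smul, Submodule.subtypeL_apply, innerSL_apply_apply, h0, smul_zero]

/-- A compact symmetric operator has a Hilbert basis of eigenvectors. -/
lemma exists_hilbertBasis_eigenvectors (K : H →L[ℂ] H) (hK : IsCompactOperator K)
    (hsymm : ∀ f g, ⟪K f, g⟫_ℂ = ⟪f, K g⟫_ℂ) :
    ∃ (ι : Type w) (b : HilbertBasis ι ℂ H) (m : ι → ℝ), ∀ i, K (b i) = (m i : ℂ) • b i := by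
  have hs : (K : H →ₗ[ℂ] H).IsSymmetric := hsymm
  obtain ⟨ι, v, m, hv, hKv, htot⟩ := exists_orthonormal_eigenvectors K hsymm
  -- A vector orthogonal to the whole family is orthogonal to every eigenspace, and for a compact
  -- symmetric operator only 0 is.
  have hbot : (Submodule.span ℂ (range v))ᗮ = ⊥ := by
    rw [eq_bot_iff, ← ContinuousLinearMap.orthogonalComplement_iSup_eigenspaces_eq_bot hK hs]
    intro x hx
    rw [Submodule.mem_orthogonal'] at hx
    rw [← Submodule.iInf_orthogonal, Submodule.mem_iInf]
    intro z
    rw [Submodule.mem_orthogonal']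
    exact fun y hy => htot x (fun i => hx _ (Submodule.subset_span (mem_range_self i))) z y
      (Module.End.mem_eigenspace_iff.1 hy)
  refine ⟨ι, HilbertBasis.mkOfOrthogonalEqBot hv hbot, fun a => (m a).re, fun a => ?_⟩
  rw [HilbertBasis.coe_mkOfOrthogonalEqBot, hKv]
  have : Module.End.HasEigenvalue (K : Module.End ℂ H) (m a) :=
    Module.End.hasEigenvalue_of_hasEigenvector
      ⟨Module.End.mem_eigenspace_iff.2 (hKv a), hv.ne_zero a⟩
  rw [Complex.conj_eq_iff_re.1 (hs.conj_eigenvalue_eq_self this)]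

end Abstract

/-! ### Eigenfunctions of the Sturm-Liouville operator -/

/-- K is the inverse of 𝓛 + c. The choice c = ‖q‖ + 1 dominates multiplication by q and is positive
even when q = 0. -/
lemma exists_resolvent (q : Linf) : ∃ c : ℝ, 0 < c ∧ ∃ K : L2 →L[ℂ] L2, IsCompactOperator K ∧
    (∀ f g, ⟪K f, g⟫_ℂ = ⟪f, K g⟫_ℂ) ∧ ∀ y g : L2, SL q y g ↔ y = K (g + (c : ℂ) • y) := by
  have hc : ∀ f, ‖mulOp q f‖ ≤ (‖q‖ + 1) * ‖f‖ := fun f =>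
    (norm_mulOp_apply_le q f).trans
      (mul_le_mul_of_nonneg_right (by linarith) (norm_nonneg f))
  obtain ⟨K, hK, hs, h⟩ := exists_shifted_resolvent sqrtGreen (mulOp q)
    isCompactOperator_sqrtGreen (inner_mulOp q) (‖q‖ + 1) hc
  exact ⟨‖q‖ + 1, by positivity, K, hK, hs, fun y g => (sl_iff_eq_green q y g).trans (h y g)⟩

lemma SL.smul {q : Linf} {y g : L2} (h : SL q y g) (a : ℂ) : SL q (a • y) (a • g) := by
  obtain ⟨c, -, K, -, -, hK⟩ := exists_resolvent q
  rw [hK] at h ⊢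
  rw [smul_comm, ← smul_add, map_smul, ← h]

/-- Symmetry of K, with the eigenvalue equation written φ = (l + c)Kφ so that nothing is divided by
l + c. -/
lemma IsEigenpair.inner_eq_zero {q : Linf} {l l' : ℝ} {φ φ' : L2} (h : IsEigenpair q l φ)
    (h' : IsEigenpair q l' φ') (hne : l ≠ l') : ⟪φ, φ'⟫_ℂ = 0 := by
  obtain ⟨c, -, K, -, hs, hK⟩ := exists_resolvent q
  have h1 : φ = ((l + c : ℝ) : ℂ) • K φ := by
    rw [← map_smul, Complex.ofReal_add, add_smul]; exact (hK _ _).1 h.2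
  have h2 : φ' = ((l' + c : ℝ) : ℂ) • K φ' := by
    rw [← map_smul, Complex.ofReal_add, add_smul]; exact (hK _ _).1 h'.2
  have e1 : ⟪φ, φ'⟫_ℂ = ((l + c : ℝ) : ℂ) * ⟪φ, K φ'⟫_ℂ := by
    conv_lhs => rw [h1]
    rw [inner_smul_left, Complex.conj_ofReal, hs]
  have e2 : ⟪φ, φ'⟫_ℂ = ((l' + c : ℝ) : ℂ) * ⟪φ, K φ'⟫_ℂ := by
    conv_lhs => rw [h2]
    rw [inner_smul_right]
  have e3 : ((l - l' : ℝ) : ℂ) * ⟪φ, K φ'⟫_ℂ = 0 := by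
    have := e1.symm.trans e2
    push_cast at this ⊢
    linear_combination this
  rcases mul_eq_zero.1 e3 with h3 | h3
  · exact absurd (sub_eq_zero.1 (by exact_mod_cast h3)) hne
  · rw [e1, h3, mul_zero]

lemma IsEigenpair.isTest {q : Linf} {l : ℝ} {φ : L2} (h : IsEigenpair q l φ) : IsTest q φ :=
  ⟨fun j => ((l : ℂ) ^ j) • φ, by simp, fun j => by
    have := h.2.smul ((l : ℂ) ^ j)
    rwa [smul_smul, ← pow_succ] at this⟩

/-- Against other eigenvalues both sides vanish by orthogonality. With `IsEigenpair.isTest` this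
allows eigenfunctions as test functions in the wave equation. -/
lemma IsEigenpair.isPow {q : Linf} {l : ℝ} {φ : L2} (h : IsEigenpair q l φ) (r : ℝ) :
    IsPow q r φ (((l ^ r : ℝ) : ℂ) • φ) := by
  intro l' φ' h'
  rw [inner_smul_right]
  rcases eq_or_ne l' l with rfl | hne
  · rfl
  · rw [h'.inner_eq_zero h hne, mul_zero, mul_zero]

/-- The Dirichlet eigenfunctions form a Hilbert basis, and if all eigenvalues are positive, they
are bounded below by a positive number. -/
lemma exists_eigenbasis {q : Linf} (hq : PositiveSpectrum q) :
    ∃ (ι : Type) (_ : Countable ι) (e : HilbertBasis ι ℂ L2) (lam : ι → ℝ) (δ : ℝ),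
      0 < δ ∧ (∀ i, δ ≤ lam i) ∧ ∀ i, IsEigenpair q (lam i) (e i) := by
  obtain ⟨c, hc, K, hKc, hs, hK⟩ := exists_resolvent q
  obtain ⟨ι, e, m, he⟩ := exists_hilbertBasis_eigenvectors K hKc hs
  have : Fact ((2 : ℝ≥0∞) ≠ ∞) := ⟨by norm_num⟩
  have hcount : Countable ι := e.orthonormal.countable_index
  have he0 : ∀ i, e i ≠ 0 := fun i => e.orthonormal.ne_zero i
  have hm : ∀ i, m i ≠ 0 := by
    intro i hi
    refine he0 i (eq_zero_of_sl_zero (q := q) ((hK _ _).2 ?_))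
    rw [smul_zero, add_zero, he, hi, Complex.ofReal_zero, zero_smul]
  have hpair : ∀ i, IsEigenpair q ((m i)⁻¹ - c) (e i) := by
    intro i
    refine ⟨he0 i, (hK _ _).2 ?_⟩
    have hmi : (m i : ℂ) ≠ 0 := by exact_mod_cast hm i
    rw [← add_smul, map_smul, he, smul_smul]
    push_cast
    rw [sub_add_cancel, inv_mul_cancel₀ hmi, one_smul]
  -- The value 1/c for K corresponds to the eigenvalue 0 of 𝓛, which positivity excludes.
  obtain ⟨δ, hδ, hb⟩ := exists_le_abs_sub_eigenvalue K hKc (z := c⁻¹) (by positivity) (by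
    intro x hx
    by_contra hx0
    refine lt_irrefl (0 : ℝ) (hq 0 x ⟨hx0, (hK _ _).2 ?_⟩)
    have hcc : (c : ℂ) ≠ 0 := by exact_mod_cast hc.ne'
    rw [Complex.ofReal_zero, zero_smul, zero_add, map_smul, hx, smul_smul, Complex.ofReal_inv,
      mul_inv_cancel₀ hcc, one_smul])
  -- Multiplying 1/c - m ≥ δ by c/m gives 1/m - c ≥ δc/m, and 1/m > c then yields the bound δc².
  refine ⟨ι, hcount, e, fun i => (m i)⁻¹ - c, δ * c ^ 2, by positivity, fun i => ?_, hpair⟩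
  have h1 := hb (m i) (e i) (he0 i) (he i)
  have h2 : 0 < (m i)⁻¹ - c := hq _ _ (hpair i)
  have h3 : 0 < m i := inv_pos.1 (by linarith)
  have h4 : m i < c⁻¹ := by
    rw [lt_inv_comm₀ h3 hc]; linarith
  rw [abs_of_neg (by linarith), neg_sub] at h1
  have h5 : δ * (c * (m i)⁻¹) ≤ (m i)⁻¹ - c := by
    have := mul_le_mul_of_nonneg_right h1 (show 0 ≤ c * (m i)⁻¹ by positivity)
    refine this.trans (le_of_eq ?_)
    field_simp
  refine le_trans ?_ h5
  rw [sq]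
  gcongr
  linarith

/-! ### Coordinates and fractional powers -/

section Coordinates

variable {q : Linf} {ι : Type} {e : HilbertBasis ι ℂ L2} {lam : ι → ℝ}

lemma isPow_pow {s : ℝ} {f : L2} (hf : MemW q s f) : IsPow q (s / 2) f (pow q (s / 2) f) := by
  unfold pow
  rw [dif_pos (show ∃ g, IsPow q (s / 2) f g from hf)]
  exact hf.choose_spec

lemma IsPow.sub {r : ℝ} {f g f' g' : L2} (h : IsPow q r f g) (h' : IsPow q r f' g') :
    IsPow q r (f - f') (g - g') := by
  intro l φ hφ
  rw [inner_sub_right, inner_sub_right, h l φ hφ, h' l φ hφ, mul_sub]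

lemma MemW.sub {s : ℝ} {f f' : L2} (h : MemW q s f) (h' : MemW q s f') : MemW q s (f - f') :=
  ⟨_, h.choose_spec.sub h'.choose_spec⟩

lemma hasSum_norm_sq_inner (e : HilbertBasis ι ℂ L2) (f : L2) :
    HasSum (fun i => ‖⟪e i, f⟫_ℂ‖ ^ 2) (‖f‖ ^ 2) := by
  have h := (e.hasSum_inner_mul_inner f f).mapL Complex.reCLM
  have h1 : Complex.reCLM ⟪f, f⟫_ℂ = ‖f‖ ^ 2 := inner_self_eq_norm_sq (𝕜 := ℂ) f
  rw [h1] at h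
  convert h using 2 with i
  have h2 := inner_mul_symm_re_eq_norm (𝕜 := ℂ) f (e i)
  rw [norm_mul, norm_inner_symm, ← sq] at h2
  exact h2.symm

/-- Parseval: each coordinate is multiplied by at least δ^(s/2), as s ≥ 0. This is where the gap at
0 is used. -/
lemma norm_le_mul_normW {δ s : ℝ} (hδ : 0 < δ) (hs : 0 ≤ s) (hlam : ∀ i, δ ≤ lam i)
    (he : ∀ i, IsEigenpair q (lam i) (e i)) {f : L2} (hf : MemW q s f) :
    ‖f‖ ≤ (δ ^ (s / 2))⁻¹ * normW q s f := by
  have hδs : 0 < δ ^ (s / 2) := Real.rpow_pos_of_pos hδ _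
  rw [← mul_le_mul_iff_right₀ hδs, mul_inv_cancel_left₀ hδs.ne']
  refine le_of_sq_le_sq ?_ (norm_nonneg _)
  rw [mul_pow]
  refine hasSum_le (fun i => ?_) ((hasSum_norm_sq_inner e f).mul_left _)
    (hasSum_norm_sq_inner e (pow q (s / 2) f))
  rw [isPow_pow hf _ _ (he i), norm_mul, mul_pow, Complex.norm_real, Real.norm_eq_abs,
    abs_of_nonneg (Real.rpow_nonneg (hδ.le.trans (hlam i)) _)]
  gcongr
  exact hlam i

end Coordinates

/-! ### Energy estimate -/

lemma hasDerivWithinAt_normSq {f : ℝ → ℂ} {f' : ℂ} {S : Set ℝ} {t : ℝ}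
    (h : HasDerivWithinAt f f' S t) :
    HasDerivWithinAt (fun τ => ‖f τ‖ ^ 2) (2 * (starRingEnd ℂ (f t) * f').re) S t := by
  have := h.norm_sq
  rw [Complex.inner, mul_comm f'] at this
  exact this

lemma hasDerivWithinAt_integral_Icc {T : ℝ} {g : ℝ → ℝ} (hg : ContinuousOn g (Icc 0 T)) {t : ℝ}
    (ht : t ∈ Icc 0 T) : HasDerivWithinAt (fun x => ∫ τ in (0 : ℝ)..x, g τ) (g t) (Icc 0 T) t := by
  have : Fact (t ∈ Icc (0 : ℝ) T) := ⟨ht⟩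
  refine intervalIntegral.integral_hasDerivWithinAt_right ?_ ?_ (hg t ht)
  · exact ContinuousOn.intervalIntegrable (by
      rw [uIcc_of_le ht.1]; exact hg.mono (Icc_subset_Icc_right ht.2))
  · exact hg.stronglyMeasurableAtFilter_nhdsWithin measurableSet_Icc t

section Energy

variable {ι : Type} {e : HilbertBasis ι ℂ L2} {lam : ι → ℝ} {s T : ℝ} {w v h A : ℝ → L2}

/-- A bound uniform in the finite set, serving as the dominating function in `energy_integral`. -/
lemma re_sum_inner_le (e : HilbertBasis ι ℂ L2) (S : Finset ι) (f g : L2) :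
    |∑ i ∈ S, 2 * (⟪f, e i⟫_ℂ * ⟪e i, g⟫_ℂ).re| ≤ ‖f‖ ^ 2 + ‖g‖ ^ 2 := by
  refine (Finset.abs_sum_le_sum_abs _ _).trans ?_
  have h1 : ∀ i ∈ S, |2 * (⟪f, e i⟫_ℂ * ⟪e i, g⟫_ℂ).re| ≤
      ‖⟪e i, f⟫_ℂ‖ ^ 2 + ‖⟪e i, g⟫_ℂ‖ ^ 2 := by
    intro i _
    have h2 := Complex.abs_re_le_norm (⟪f, e i⟫_ℂ * ⟪e i, g⟫_ℂ)
    rw [norm_mul, norm_inner_symm] at h2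
    rw [abs_mul, abs_two]
    nlinarith [sq_nonneg (‖⟪e i, f⟫_ℂ‖ - ‖⟪e i, g⟫_ℂ‖)]
  refine (Finset.sum_le_sum h1).trans ?_
  rw [Finset.sum_add_distrib]
  exact add_le_add (e.orthonormal.sum_inner_products_le f) (e.orthonormal.sum_inner_products_le g)

/-- Conservation of energy for `w'' + 𝓛^s w = h`, in integrated form. -/
lemma energy_integral [Countable ι] (hlam : ∀ i, 0 < lam i)
    (hw : ∀ t ∈ Icc (0 : ℝ) T, HasDerivWithinAt w (v t) (Icc 0 T) t)
    (hv : ContinuousOn v (Icc 0 T)) (hh : ContinuousOn h (Icc 0 T))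
    (hA : ∀ t ∈ Icc (0 : ℝ) T, ∀ i,
      ⟪e i, A t⟫_ℂ = ((lam i ^ (s / 2) : ℝ) : ℂ) * ⟪e i, w t⟫_ℂ)
    (heq : ∀ i, ∀ t ∈ Icc (0 : ℝ) T, HasDerivWithinAt (fun τ => ⟪e i, v τ⟫_ℂ)
      (-(((lam i ^ s : ℝ) : ℂ) * ⟪e i, w t⟫_ℂ) + ⟪e i, h t⟫_ℂ) (Icc 0 T) t)
    {t : ℝ} (ht : t ∈ Icc (0 : ℝ) T) :
    ‖v t‖ ^ 2 + ‖A t‖ ^ 2 = ‖v 0‖ ^ 2 + ‖A 0‖ ^ 2 +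
      ∫ τ in (0 : ℝ)..t, 2 * (⟪v τ, h τ⟫_ℂ).re := by
  have hT : (0 : ℝ) ∈ Icc 0 T := ⟨le_rfl, ht.1.trans ht.2⟩
  have hsub : Icc 0 t ⊆ Icc 0 T := Icc_subset_Icc_right ht.2
  set G : Finset ι → ℝ → ℝ := fun S τ => ∑ i ∈ S, 2 * (⟪v τ, e i⟫_ℂ * ⟪e i, h τ⟫_ℂ).re with hG
  have hGc : ∀ S, ContinuousOn (G S) (Icc 0 T) := fun S =>
    continuousOn_finsetSum _ fun i _ => continuousOn_const.mul
      (Complex.continuous_re.comp_continuousOn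
        ((hv.inner continuousOn_const).mul (continuousOn_const.inner hh)))
  -- The full energy is not known to be differentiable beforehand, because 𝓛^s w has meaning only
  -- against test functions. Its finite truncations are differentiable; the terms in λ^s cancel in
  -- the derivative, leaving only the source.
  set E : Finset ι → ℝ → ℝ := fun S τ =>
    ∑ i ∈ S, (‖⟪e i, v τ⟫_ℂ‖ ^ 2 + ‖⟪e i, A τ⟫_ℂ‖ ^ 2) with hE
  have hEderiv : ∀ S, ∀ τ ∈ Icc 0 T, HasDerivWithinAt (E S) (G S τ) (Icc 0 T) τ := by
    intro S τ hτ
    refine HasDerivWithinAt.fun_sum fun i _ => ?_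
    set α : ℝ := lam i ^ (s / 2) with hα
    have hα2 : lam i ^ s = α ^ 2 := by
      rw [hα, ← Real.rpow_natCast, ← Real.rpow_mul (hlam i).le]; norm_num
    have hwi : HasDerivWithinAt (fun τ => ⟪e i, w τ⟫_ℂ) ⟪e i, v τ⟫_ℂ (Icc 0 T) τ :=
      ((innerSL ℂ (e i)).restrictScalars ℝ).hasFDerivAt.comp_hasDerivWithinAt τ (hw τ hτ)
    have hAi : HasDerivWithinAt (fun τ => ‖⟪e i, A τ⟫_ℂ‖ ^ 2)
        (α ^ 2 * (2 * (starRingEnd ℂ ⟪e i, w τ⟫_ℂ * ⟪e i, v τ⟫_ℂ).re)) (Icc 0 T) τ := by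
      have hc : ∀ x ∈ Icc (0 : ℝ) T, ‖⟪e i, A x⟫_ℂ‖ ^ 2 = α ^ 2 * ‖⟪e i, w x⟫_ℂ‖ ^ 2 := by
        intro x hx
        rw [hA x hx i, norm_mul, mul_pow, Complex.norm_real, Real.norm_eq_abs, sq_abs]
      exact ((hasDerivWithinAt_normSq hwi).const_mul (α ^ 2)).congr hc (hc τ hτ)
    refine ((hasDerivWithinAt_normSq (heq i τ hτ)).add hAi).congr_deriv ?_
    rw [hα2, ← inner_conj_symm (v τ) (e i)]
    simp only [Complex.mul_re, Complex.add_re, Complex.neg_re, Complex.mul_im, Complex.add_im,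
      Complex.neg_im, Complex.conj_re, Complex.conj_im, Complex.ofReal_re, Complex.ofReal_im]
    ring
  have hFTC : ∀ S, E S t - E S 0 = ∫ τ in (0 : ℝ)..t, G S τ := by
    intro S
    symm
    refine intervalIntegral.integral_eq_sub_of_hasDerivAt_of_le ht.1
      (fun τ hτ => ((hEderiv S τ (hsub hτ)).continuousWithinAt).mono hsub)
      (fun τ hτ => (hEderiv S τ (hsub (Ioo_subset_Icc_self hτ))).hasDerivAt
        (Icc_mem_nhds hτ.1 (hτ.2.trans_le ht.2))) ?_
    exact ContinuousOn.intervalIntegrable (by rw [uIcc_of_le ht.1]; exact (hGc S).mono hsub)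
  have hlim1 : Tendsto (fun S => E S t - E S 0) atTop
      (𝓝 (‖v t‖ ^ 2 + ‖A t‖ ^ 2 - (‖v 0‖ ^ 2 + ‖A 0‖ ^ 2))) :=
    Tendsto.sub ((hasSum_norm_sq_inner e (v t)).add (hasSum_norm_sq_inner e (A t)))
      ((hasSum_norm_sq_inner e (v 0)).add (hasSum_norm_sq_inner e (A 0)))
  -- The limit is taken after integrating in time, so no derivative has to converge.
  have hlim2 : Tendsto (fun S => ∫ τ in (0 : ℝ)..t, G S τ) atTop
      (𝓝 (∫ τ in (0 : ℝ)..t, 2 * (⟪v τ, h τ⟫_ℂ).re)) := by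
    have hmem : ∀ τ ∈ uIoc 0 t, τ ∈ Icc 0 T := fun τ hτ => by
      rw [uIoc_of_le ht.1] at hτ; exact hsub (Ioc_subset_Icc_self hτ)
    refine intervalIntegral.tendsto_integral_filter_of_dominated_convergence
      (fun τ => ‖v τ‖ ^ 2 + ‖h τ‖ ^ 2) (Eventually.of_forall fun S => ?_)
      (Eventually.of_forall fun S => ae_of_all _ fun τ _ => re_sum_inner_le e S (v τ) (h τ)) ?_
      (ae_of_all _ fun τ _ => ?_)
    · exact ((hGc S).mono hmem).aestronglyMeasurable measurableSet_uIoc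
    · refine ContinuousOn.intervalIntegrable ?_
      rw [uIcc_of_le ht.1]
      exact ((hv.mono hsub).norm.pow 2).add ((hh.mono hsub).norm.pow 2)
    · exact ((e.hasSum_inner_mul_inner (v τ) (h τ)).mapL Complex.reCLM).mul_left 2
  have := tendsto_nhds_unique (hlim1.congr hFTC) hlim2
  linarith

/-- The energy inequality for `w'' + 𝓛^s w + a w + b w' = F` with non-negative `a` and `b`. -/
lemma energy_le [Countable ι] (hlam : ∀ i, 0 < lam i) (hT : 0 < T) {a b : Linf} (ha : 0 ≤ a)
    (hb : 0 ≤ b) {F : ℝ → L2} {R : ℝ}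
    (hw : ∀ t ∈ Icc (0 : ℝ) T, HasDerivWithinAt w (v t) (Icc 0 T) t)
    (hv : ContinuousOn v (Icc 0 T)) (hF : ContinuousOn F (Icc 0 T))
    (hA : ∀ t ∈ Icc (0 : ℝ) T, ∀ i,
      ⟪e i, A t⟫_ℂ = ((lam i ^ (s / 2) : ℝ) : ℂ) * ⟪e i, w t⟫_ℂ)
    (heq : ∀ i, ∀ t ∈ Icc (0 : ℝ) T, HasDerivWithinAt (fun τ => ⟪e i, v τ⟫_ℂ)
      (-(((lam i ^ s : ℝ) : ℂ) * ⟪e i, w t⟫_ℂ) +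
        ⟪e i, F t - mulOp a (w t) - mulOp b (v t)⟫_ℂ) (Icc 0 T) t)
    (hFR : ∀ t ∈ Icc (0 : ℝ) T, ‖F t‖ ≤ R) {t : ℝ} (ht : t ∈ Icc (0 : ℝ) T) :
    ‖v t‖ ^ 2 ≤ Real.exp T * (‖v 0‖ ^ 2 + ‖A 0‖ ^ 2 + ‖a‖ * ‖w 0‖ ^ 2 + R ^ 2) := by
  have hwc : ContinuousOn w (Icc 0 T) := fun t ht => (hw t ht).continuousWithinAt
  set h : ℝ → L2 := fun t => F t - mulOp a (w t) - mulOp b (v t) with hh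
  have hhc : ContinuousOn h (Icc 0 T) :=
    (hF.sub ((mulOp a).continuous.comp_continuousOn hwc)).sub
      ((mulOp b).continuous.comp_continuousOn hv)
  -- Including the potential energy of a cancels the term a w exactly; estimating it instead would
  -- put ‖a‖ into the exponential.
  set E : ℝ → ℝ := fun t => ‖v t‖ ^ 2 + ‖A t‖ ^ 2 + (⟪mulOp a (w t), w t⟫_ℂ).re with hE
  have hE0 : ∀ t, ‖v t‖ ^ 2 ≤ E t := fun t => by
    have := re_inner_mulOp_nonneg ha (w t)
    simp only [hE]; nlinarith [sq_nonneg ‖A t‖]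
  have hderiv : ∀ t ∈ Icc 0 T, HasDerivWithinAt E
      (2 * (⟪v t, F t⟫_ℂ).re - 2 * (⟪mulOp b (v t), v t⟫_ℂ).re) (Icc 0 T) t := by
    intro t ht
    have hgc : ContinuousOn (fun τ => 2 * (⟪v τ, h τ⟫_ℂ).re) (Icc 0 T) :=
      continuousOn_const.mul (Complex.continuous_re.comp_continuousOn (hv.inner hhc))
    have h1 : HasDerivWithinAt (fun τ => ‖v τ‖ ^ 2 + ‖A τ‖ ^ 2) (2 * (⟪v t, h t⟫_ℂ).re)
        (Icc 0 T) t :=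
      ((hasDerivWithinAt_integral_Icc hgc ht).const_add (‖v 0‖ ^ 2 + ‖A 0‖ ^ 2)).congr
        (fun τ hτ => energy_integral hlam hw hv hhc hA heq hτ)
        (energy_integral hlam hw hv hhc hA heq ht)
    have h2 : HasDerivWithinAt (fun τ => mulOp a (w τ)) (mulOp a (v t)) (Icc 0 T) t :=
      ((mulOp a).restrictScalars ℝ).hasFDerivAt.comp_hasDerivWithinAt t (hw t ht)
    have h3 : HasDerivWithinAt (fun τ => (⟪mulOp a (w τ), w τ⟫_ℂ).re)
        (⟪mulOp a (w t), v t⟫_ℂ + ⟪mulOp a (v t), w t⟫_ℂ).re (Icc 0 T) t :=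
      Complex.reCLM.hasFDerivAt.comp_hasDerivWithinAt t (h2.inner ℂ (hw t ht))
    refine (h1.add h3).congr_deriv ?_
    have hre : ∀ x y : L2, (⟪x, y⟫_ℂ).re = (⟪y, x⟫_ℂ).re := fun x y => by
      rw [← inner_conj_symm, Complex.conj_re]
    simp only [hh, inner_sub_right, Complex.sub_re, Complex.add_re]
    rw [hre (mulOp a (w t)) (v t), inner_mulOp a (v t) (w t), hre (mulOp b (v t)) (v t)]
    ring
  -- The damping term has a favourable sign since b ≥ 0, and 2‖v‖‖F‖ ≤ ‖v‖² + R².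
  have hle : ∀ t ∈ Icc 0 T,
      2 * (⟪v t, F t⟫_ℂ).re - 2 * (⟪mulOp b (v t), v t⟫_ℂ).re ≤ R ^ 2 + E t := by
    intro t ht
    have h1 := re_inner_mulOp_nonneg hb (v t)
    have h2 := (Complex.re_le_norm _).trans (norm_inner_le_norm (𝕜 := ℂ) (v t) (F t))
    have h3 := pow_le_pow_left₀ (norm_nonneg _) (hFR t ht) 2
    nlinarith [hE0 t, sq_nonneg (‖v t‖ - ‖F t‖)]
  -- Gronwall's argument for E' ≤ E + R².
  have hanti : AntitoneOn (fun t => Real.exp (-t) * (E t + R ^ 2)) (Icc 0 T) := by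
    refine antitoneOn_of_hasDerivWithinAt_nonpos (convex_Icc 0 T)
      (f' := fun t => Real.exp (-t) * (-1) * (E t + R ^ 2) + Real.exp (-t) *
        (2 * (⟪v t, F t⟫_ℂ).re - 2 * (⟪mulOp b (v t), v t⟫_ℂ).re)) ?_ ?_ ?_
    · exact (Real.continuous_exp.comp continuous_neg).continuousOn.mul
        (ContinuousOn.add (fun t ht => (hderiv t ht).continuousWithinAt) continuousOn_const)
    · intro t ht
      refine HasDerivWithinAt.mono ?_ interior_subset
      have h1 : HasDerivAt (fun t : ℝ => Real.exp (-t)) (Real.exp (-t) * (-1)) t :=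
        (hasDerivAt_neg t).exp
      exact h1.hasDerivWithinAt.mul ((hderiv t (interior_subset ht)).add_const _)
    · intro t ht
      have h1 := hle t (interior_subset ht)
      have h2 := Real.exp_pos (-t)
      nlinarith
  have h0 : (0 : ℝ) ∈ Icc 0 T := ⟨le_rfl, hT.le⟩
  have h1 := hanti h0 ht ht.1
  simp only [neg_zero, Real.exp_zero, one_mul] at h1
  have h2 : E t + R ^ 2 ≤ Real.exp t * (E 0 + R ^ 2) := by
    have := mul_le_mul_of_nonneg_left h1 (Real.exp_pos t).le
    rwa [← mul_assoc, ← Real.exp_add, add_neg_cancel, Real.exp_zero, one_mul] at this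
  have h3 : E 0 ≤ ‖v 0‖ ^ 2 + ‖A 0‖ ^ 2 + ‖a‖ * ‖w 0‖ ^ 2 := by
    have := (Complex.re_le_norm _).trans (norm_inner_le_norm (𝕜 := ℂ) (mulOp a (w 0)) (w 0))
    have h4 := mul_le_mul_of_nonneg_right (norm_mulOp_apply_le a (w 0)) (norm_nonneg (w 0))
    simp only [hE]; nlinarith
  have h5 : 0 ≤ E 0 + R ^ 2 := by nlinarith [hE0 0, sq_nonneg ‖v 0‖, sq_nonneg R]
  calc ‖v t‖ ^ 2 ≤ E t + R ^ 2 := by nlinarith [hE0 t, sq_nonneg R]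
    _ ≤ Real.exp t * (E 0 + R ^ 2) := h2
    _ ≤ Real.exp T * (E 0 + R ^ 2) :=
        mul_le_mul_of_nonneg_right (Real.exp_le_exp.2 ht.2) h5
    _ ≤ _ := mul_le_mul_of_nonneg_left (by linarith) (Real.exp_pos T).le

/-- The solution and its time derivative are controlled by the data, linearly in `‖a‖`. -/
lemma norm_solution_le [Countable ι] (hlam : ∀ i, 0 < lam i) (hT : 0 < T) {a b : Linf} (ha : 0 ≤ a)
    (hb : 0 ≤ b) {F : ℝ → L2} {R : ℝ}
    (hw : ∀ t ∈ Icc (0 : ℝ) T, HasDerivWithinAt w (v t) (Icc 0 T) t)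
    (hv : ContinuousOn v (Icc 0 T)) (hF : ContinuousOn F (Icc 0 T))
    (hA : ∀ t ∈ Icc (0 : ℝ) T, ∀ i,
      ⟪e i, A t⟫_ℂ = ((lam i ^ (s / 2) : ℝ) : ℂ) * ⟪e i, w t⟫_ℂ)
    (heq : ∀ i, ∀ t ∈ Icc (0 : ℝ) T, HasDerivWithinAt (fun τ => ⟪e i, v τ⟫_ℂ)
      (-(((lam i ^ s : ℝ) : ℂ) * ⟪e i, w t⟫_ℂ) +
        ⟪e i, F t - mulOp a (w t) - mulOp b (v t)⟫_ℂ) (Icc 0 T) t)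
    (hv0 : ‖v 0‖ ≤ R) (hA0 : ‖A 0‖ ≤ R) (hw0 : ‖w 0‖ ≤ R)
    (hFR : ∀ t ∈ Icc (0 : ℝ) T, ‖F t‖ ≤ R) {t : ℝ} (ht : t ∈ Icc (0 : ℝ) T) :
    ‖w t‖ ≤ (1 + T) * Real.exp T * (3 + ‖a‖) * R ∧
      ‖v t‖ ≤ (1 + T) * Real.exp T * (3 + ‖a‖) * R := by
  have hR : 0 ≤ R := (norm_nonneg _).trans hv0
  have hexp : 1 ≤ Real.exp T := Real.one_le_exp hT.le
  -- The 3 counts the contributions of `v 0`, `A 0` and `F`, and ‖a‖ that of `w 0`. Being at least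
  -- 1, this factor may replace its own square root.
  have hκ : 1 ≤ Real.exp T * (3 + ‖a‖) := one_le_mul_of_one_le_of_one_le hexp (by
    linarith [norm_nonneg a])
  have hvb : ∀ t ∈ Icc (0 : ℝ) T, ‖v t‖ ≤ Real.exp T * (3 + ‖a‖) * R := by
    intro t ht
    refine le_of_sq_le_sq ?_ (by positivity)
    have h1 := pow_le_pow_left₀ (norm_nonneg _) hv0 2
    have h2 := pow_le_pow_left₀ (norm_nonneg _) hA0 2
    have h3 := mul_le_mul_of_nonneg_left (pow_le_pow_left₀ (norm_nonneg _) hw0 2) (norm_nonneg a)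
    calc ‖v t‖ ^ 2 ≤ Real.exp T * (‖v 0‖ ^ 2 + ‖A 0‖ ^ 2 + ‖a‖ * ‖w 0‖ ^ 2 + R ^ 2) :=
          energy_le hlam hT ha hb hw hv hF hA heq hFR ht
      _ ≤ Real.exp T * ((3 + ‖a‖) * R ^ 2) :=
          mul_le_mul_of_nonneg_left (by linarith) (Real.exp_pos T).le
      _ = Real.exp T * (3 + ‖a‖) * R ^ 2 := by ring
      _ ≤ (Real.exp T * (3 + ‖a‖)) ^ 2 * R ^ 2 :=
          mul_le_mul_of_nonneg_right (le_self_pow₀ hκ two_ne_zero) (sq_nonneg R)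
      _ = _ := by ring
  set κ := Real.exp T * (3 + ‖a‖) with hκd
  have hκR : 0 ≤ κ * R := by positivity
  rw [mul_assoc (1 + T)]
  constructor
  -- The energy controls the velocity; `w` itself is recovered by the mean value inequality, at the
  -- cost of the factor 1 + T.
  · have h1 := (convex_Icc (0 : ℝ) T).norm_image_sub_le_of_norm_hasDerivWithin_le hw hvb
      ⟨le_rfl, hT.le⟩ ht
    rw [sub_zero, Real.norm_of_nonneg ht.1] at h1
    have h2 : ‖w t‖ ≤ ‖w t - w 0‖ + ‖w 0‖ := by simpa using norm_add_le (w t - w 0) (w 0)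
    have h3 : κ * R * t ≤ κ * R * T := mul_le_mul_of_nonneg_left ht.2 hκR
    have h4 : R ≤ κ * R := le_mul_of_one_le_left hR hκ
    nlinarith
  · have := hvb t ht
    nlinarith

end Energy

/-! ### Moderate and negligible nets of numbers -/

section Nets

variable {f g : ℝ → ℝ}

lemma isModerate_const {c : ℝ} (hc : 0 ≤ c) : IsModerate id (fun _ : ℝ => c) :=
  ⟨0, c + 1, by linarith, fun ε _ => by simp⟩

lemma IsModerate.add (hf : IsModerate id f) (hg : IsModerate id g) :
    IsModerate id (fun ε => f ε + g ε) := by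
  obtain ⟨N, C, hC, h⟩ := hf
  obtain ⟨M, D, hD, h'⟩ := hg
  refine ⟨N + M, C + D, by linarith, fun ε hε => ?_⟩
  have h1 : ε ^ (-(N : ℝ)) ≤ ε ^ (-((N + M : ℕ) : ℝ)) :=
    Real.rpow_le_rpow_of_exponent_ge hε.1 hε.2 (by push_cast; linarith [M.cast_nonneg (α := ℝ)])
  have h2 : ε ^ (-(M : ℝ)) ≤ ε ^ (-((N + M : ℕ) : ℝ)) :=
    Real.rpow_le_rpow_of_exponent_ge hε.1 hε.2 (by push_cast; linarith [N.cast_nonneg (α := ℝ)])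
  have h3 := h ε hε
  have h4 := h' ε hε
  simp only [id] at *
  nlinarith

lemma IsModerate.mul (hf : IsModerate id f) (hg : IsModerate id g) (hg0 : ∀ ε, 0 ≤ g ε) :
    IsModerate id (fun ε => f ε * g ε) := by
  obtain ⟨N, C, hC, h⟩ := hf
  obtain ⟨M, D, hD, h'⟩ := hg
  refine ⟨N + M, C * D, by positivity, fun ε hε => ?_⟩
  have hε0 := hε.1
  calc f ε * g ε ≤ (C * ε ^ (-(N : ℝ))) * (D * ε ^ (-(M : ℝ))) :=
        mul_le_mul (h ε hε) (h' ε hε) (hg0 ε) (by positivity)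
    _ = C * D * ε ^ (-((N + M : ℕ) : ℝ)) := by
        push_cast
        rw [neg_add, Real.rpow_add hε0]
        ring

lemma IsNegligible.add (hf : IsNegligible id f) (hg : IsNegligible id g) :
    IsNegligible id (fun ε => f ε + g ε) := by
  intro k hk
  obtain ⟨C, hC, h⟩ := hf k hk
  obtain ⟨D, hD, h'⟩ := hg k hk
  refine ⟨C + D, by linarith, fun ε hε => ?_⟩
  have h3 := h ε hε
  have h4 := h' ε hε
  simp only [id] at *
  linarith

lemma IsModerate.mul_isNegligible (hf : IsModerate id f) (hg : IsNegligible id g)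
    (hg0 : ∀ ε, 0 ≤ g ε) : IsNegligible id (fun ε => f ε * g ε) := by
  intro k hk
  obtain ⟨N, C, hC, h⟩ := hf
  -- Negligibility at order N + k absorbs growth of order N.
  obtain ⟨D, hD, h'⟩ := hg (N + k) (by positivity)
  refine ⟨C * D, by positivity, fun ε hε => ?_⟩
  have hε0 := hε.1
  calc f ε * g ε ≤ (C * ε ^ (-(N : ℝ))) * (D * ε ^ ((N : ℝ) + k)) :=
        mul_le_mul (h ε hε) (h' ε hε) (hg0 ε) (by positivity)
    _ = C * D * (ε ^ (-(N : ℝ)) * ε ^ ((N : ℝ) + k)) := by ring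
    _ = C * D * ε ^ k := by rw [← Real.rpow_add hε0, neg_add_cancel_left]

end Nets

/-! ### Comparison of two solutions -/

section Comparison

variable {q : Linf} {ι : Type} {e : HilbertBasis ι ℂ L2} {lam : ι → ℝ} {s T : ℝ}

/-- The time derivative of a solution, with the equation in coordinates. -/
lemma IsSolution.exists_coordinates {a b : Linf} {u₀ u₁ : L2} {u : ℝ → L2}
    (h : IsSolution q s T a b u₀ u₁ u) (he : ∀ i, IsEigenpair q (lam i) (e i)) :
    ∃ v : ℝ → L2, (∀ t ∈ Icc (0 : ℝ) T, HasDerivWithinAt u (v t) (Icc 0 T) t) ∧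
      ContinuousOn v (Icc 0 T) ∧ v 0 = u₁ ∧
      ∀ i, ∀ t ∈ Icc (0 : ℝ) T, HasDerivWithinAt (fun τ => ⟪e i, v τ⟫_ℂ)
        (-(((lam i ^ s : ℝ) : ℂ) * ⟪e i, u t⟫_ℂ) +
          ⟪e i, 0 - mulOp a (u t) - mulOp b (v t)⟫_ℂ) (Icc 0 T) t := by
  obtain ⟨-, -, v, hv, hvc, -, hv0, heq⟩ := h
  refine ⟨v, hv, hvc, hv0, fun i t ht => ?_⟩
  refine (heq (e i) _ (he i).isTest ((he i).isPow s) t ht).congr_deriv ?_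
  rw [inner_smul_left, Complex.conj_ofReal, ← mulOp_apply, ← mulOp_apply]
  simp only [inner_add_right, inner_sub_right, inner_zero_right]
  ring

lemma inner_pow_eq {u : L2} (hu : MemW q s u) (he : ∀ i, IsEigenpair q (lam i) (e i)) (i : ι) :
    ⟪e i, pow q (s / 2) u⟫_ℂ = ((lam i ^ (s / 2) : ℝ) : ℂ) * ⟪e i, u⟫_ℂ :=
  isPow_pow hu _ _ (he i)

/-- Continuous dependence of solutions on the coefficients and on the data. -/
lemma norm_sub_le_of_isSolution [Countable ι] {δ : ℝ} (hδ : 0 < δ) (hs : 0 ≤ s) (hT : 0 < T)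
    (hlam : ∀ i, δ ≤ lam i) (he : ∀ i, IsEigenpair q (lam i) (e i)) {a a' b b' : Linf}
    {u₀ u₀' u₁ u₁' : L2} {u u' : ℝ → L2} (ha : 0 ≤ a) (ha' : 0 ≤ a') (hb : 0 ≤ b) (hb' : 0 ≤ b')
    (h : IsSolution q s T a b u₀ u₁ u) (h' : IsSolution q s T a' b' u₀' u₁' u')
    {κ M : ℝ} (hκ : κ = (1 + T) * Real.exp T) (hM : M = 1 + (δ ^ (s / 2))⁻¹)
    {t : ℝ} (ht : t ∈ Icc 0 T) :
    ‖u t - u' t‖ ≤ κ * (3 + ‖a‖) * (‖u₁ - u₁'‖ + M * normW q s (u₀ - u₀') +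
      κ * (3 + ‖a'‖) * (‖u₁'‖ + M * normW q s u₀') * (‖a - a'‖ + ‖b - b'‖)) := by
  have h0 : (0 : ℝ) ∈ Icc 0 T := ⟨le_rfl, hT.le⟩
  have hpos : ∀ i, 0 < lam i := fun i => hδ.trans_le (hlam i)
  have hD : 0 < (δ ^ (s / 2))⁻¹ := inv_pos.2 (Real.rpow_pos_of_pos hδ _)
  have hu0 : u 0 = u₀ := by obtain ⟨-, -, v, -, -, hu, -⟩ := h; exact hu
  have hu0' : u' 0 = u₀' := by obtain ⟨-, -, v, -, -, hu, -⟩ := h'; exact hu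
  obtain ⟨v, hv, hvc, hv0, heq⟩ := h.exists_coordinates he
  obtain ⟨v', hv', hvc', hv0', heq'⟩ := h'.exists_coordinates he
  have hwn : ∀ f : L2, 0 ≤ normW q s f := fun f => norm_nonneg _
  -- One number bounds the initial velocity, the W^s norm and the L² norm of the initial position;
  -- this dictates M.
  have hdata : ∀ {f g : L2}, MemW q s f →
      ‖g‖ ≤ ‖g‖ + M * normW q s f ∧ normW q s f ≤ ‖g‖ + M * normW q s f ∧
        ‖f‖ ≤ ‖g‖ + M * normW q s f := by
    intro f g hf
    have h1 := norm_le_mul_normW hδ hs hlam he hf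
    have h2 := hwn f
    have h3 := mul_nonneg hD.le h2
    have h4 := norm_nonneg g
    rw [hM, add_mul, one_mul]
    refine ⟨?_, ?_, ?_⟩ <;> linarith
  set B := κ * (3 + ‖a'‖) * (‖u₁'‖ + M * normW q s u₀') with hB
  have hW' : MemW q s u₀' := hu0' ▸ h'.1 0 h0
  have hbound' : ∀ t ∈ Icc 0 T, ‖u' t‖ ≤ B ∧ ‖v' t‖ ≤ B := by
    intro t ht
    have hd := hdata (g := u₁') hW'
    rw [hB, hκ]
    exact norm_solution_le (A := fun t => pow q (s / 2) (u' t)) (F := fun _ => 0)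
      hpos hT ha' hb' hv' hvc' continuousOn_const (fun t ht i => inner_pow_eq (h'.1 t ht) he i)
      heq' (hv0' ▸ hd.1) (by rw [hu0']; exact hd.2.1) (by rw [hu0']; exact hd.2.2)
      (fun t _ => by rw [norm_zero]; exact (norm_nonneg _).trans hd.1) ht
  have hB0 : 0 ≤ B := (norm_nonneg _).trans (hbound' 0 h0).1
  -- Keeping a and b on the left for the difference leaves the coefficient differences acting on the
  -- second solution, already bounded by `B`.
  set F : ℝ → L2 := fun t => -(mulOp (a - a') (u' t)) - mulOp (b - b') (v' t) with hF
  have huc' : ContinuousOn u' (Icc 0 T) := fun t ht => (hv' t ht).continuousWithinAt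
  have hFc : ContinuousOn F (Icc 0 T) :=
    ((mulOp (a - a')).continuous.comp_continuousOn huc').neg.sub
      ((mulOp (b - b')).continuous.comp_continuousOn hvc')
  have hFb : ∀ t ∈ Icc 0 T, ‖F t‖ ≤ B * (‖a - a'‖ + ‖b - b'‖) := by
    intro t ht
    have h1 := norm_sub_le (-(mulOp (a - a') (u' t))) (mulOp (b - b') (v' t))
    rw [norm_neg] at h1
    have h2 := (norm_mulOp_apply_le (a - a') (u' t)).trans
      (mul_le_mul_of_nonneg_left (hbound' t ht).1 (norm_nonneg _))
    have h3 := (norm_mulOp_apply_le (b - b') (v' t)).trans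
      (mul_le_mul_of_nonneg_left (hbound' t ht).2 (norm_nonneg _))
    simp only [hF]
    linarith
  have hW : MemW q s (u₀ - u₀') := (hu0 ▸ h.1 0 h0).sub hW'
  have hd := hdata (g := u₁ - u₁') hW
  have hBn : 0 ≤ B * (‖a - a'‖ + ‖b - b'‖) := by positivity
  rw [hκ]
  refine (norm_solution_le (w := fun t => u t - u' t) (v := fun t => v t - v' t)
    (A := fun t => pow q (s / 2) (u t - u' t)) (F := F) hpos hT ha hb
    (fun t ht => (hv t ht).sub (hv' t ht)) (hvc.sub hvc') hFc
    (fun t ht i => inner_pow_eq ((h.1 t ht).sub (h'.1 t ht)) he i) ?_ ?_ ?_ ?_ ?_ ht).1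
  · intro i t ht
    have h1 := (heq i t ht).sub (heq' i t ht)
    simp only [inner_sub_right]
    refine h1.congr_deriv ?_
    simp only [hF, mulOp_sub, map_sub, inner_sub_right, inner_neg_right, inner_zero_right]
    ring
  · simp only [hv0, hv0']; linarith [hd.1]
  · simp only [hu0, hu0']; exact hd.2.1.trans (le_add_of_nonneg_right hBn)
  · simp only [hu0, hu0']; linarith [hd.2.2]
  · intro t ht
    have := hFb t ht
    have h2 := (norm_nonneg _).trans hd.1
    linarith

end Comparison

/-! ### From fixed ε to nets -/

lemma netUniqueness_univ {s T : ℝ} (hs : 0 ≤ s) (hT : 0 < T) {q : Linf}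
    (hq : PositiveSpectrum q) : NetUniqueness q s T univ univ univ univ := by
  obtain ⟨ι, hι, e, lam, δ, hδ, hlam, he⟩ := exists_eigenbasis hq
  intro a a' _ _ ha ha' haa b b' _ _ hb hb' hbb u₀ u₀' _ _ hu₀ hu₀' hu₀u u₁ u₁' _ _ hu₁ hu₁' hu₁u
    u u' hu hu' k hk
  set κ := (1 + T) * Real.exp T with hκ
  set M := 1 + (δ ^ (s / 2))⁻¹ with hM
  have hκ0 : 0 ≤ κ := by positivity
  have hM0 : 0 ≤ M := by positivity
  have hwn : ∀ f : L2, 0 ≤ normW q s f := fun f => norm_nonneg _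
  have hca : ∀ {a : ℝ → Linf}, IsCoeffNet a → IsModerate id (fun ε => κ * (3 + ‖a ε‖)) :=
    fun h => (isModerate_const hκ0).mul ((isModerate_const (by norm_num)).add h.2)
      (fun ε => by positivity)
  have hmod : IsModerate id
      (fun ε => κ * (3 + ‖a' ε‖) * (‖u₁' ε‖ + M * normW q s (u₀' ε))) :=
    (hca ha').mul (IsModerate.add hu₁' ((isModerate_const hM0).mul hu₀'.2 (fun ε => hwn _)))
      (fun ε => add_nonneg (norm_nonneg _) (mul_nonneg hM0 (hwn _)))
  have hcoef : IsNegligible id (fun ε => ‖a ε - a' ε‖ + ‖b ε - b' ε‖) := IsNegligible.add haa hbb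
  -- The bound of `norm_sub_le_of_isSolution` as a net: a moderate factor times a negligible sum. It
  -- does not involve t, so the constants are uniform in time.
  have hneg := (hca ha).mul_isNegligible
    (IsNegligible.add (IsNegligible.add hu₁u
      ((isModerate_const hM0).mul_isNegligible hu₀u.2 (fun ε => hwn _)))
      (hmod.mul_isNegligible hcoef (fun ε => by positivity)))
    (fun ε => by
      have h1 := hwn (u₀ ε - u₀' ε)
      have h2 := hwn (u₀' ε)
      positivity)
  obtain ⟨C, hC, h⟩ := hneg k hk
  exact ⟨C, hC, fun ε hε t ht => (norm_sub_le_of_isSolution hδ hs hT hlam he (ha.1 ε hε)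
    (ha'.1 ε hε) (hb.1 ε hε) (hb'.1 ε hε) (hu ε hε) (hu' ε hε) hκ hM ht).trans (h ε hε)⟩

end FracSL

end

/-- The classes of regularisations enter only as extra hypotheses on the nets, so uniqueness for
arbitrary nets contains the distributional statement. -/
theorem mainTheorem6 (s T : ℝ) (hs : 0 ≤ s) (hT : 0 < T) (q : FracSL.Linf)
    (hq : FracSL.PositiveSpectrum q) :
    (∀ (a b : 𝓓'(FracSL.I01, ℝ)) (u₀ u₁ : 𝓓'(FracSL.I01, ℂ)),
      FracSL.HasUniqueVeryWeakSolution q s T a b u₀ u₁) ∧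
    FracSL.NetUniqueness q s T Set.univ Set.univ Set.univ Set.univ := by
  have h := FracSL.netUniqueness_univ hs hT hq
  exact ⟨fun _ _ _ _ a a' _ _ ha ha' haa b b' _ _ hb hb' hbb u₀ u₀' _ _ hu₀ hu₀' hu₀u u₁ u₁' _ _ =>
    h a a' trivial trivial ha ha' haa b b' trivial trivial hb hb' hbb u₀ u₀' trivial trivial
      hu₀ hu₀' hu₀u u₁ u₁' trivial trivial, h⟩
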